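/- For complex $s$ let $\mathrm{Li}_s(z)$ denote the principal polylogarithm: the analytic continuation of $\sum_{n\ge 1} z^n n^{-s}$ $(|z|<1)$ to $\mathbb{C}\setminus[1,\infty)$, with the value at a point of the cut $(1,\infty)$ defined, as usual, as the limit from the lower half-plane. For complex $a$ and $z\neq 0$ let $\Gamma(a,z)=\int_z^\infty t^{a-1}e^{-t}\,dt$ denote the principal upper incomplete gamma function (the path avoids $(-\infty,0]$ after its starting point, powers are principal, and on the cut $\arg z=\pi$, i.e. the path leaves $z$ into the upper half-plane). Let $k$ and $m$ be complex numbers with $e^m\neq 1$ and $|\operatorname{Im} m|<2\pi$. (Every complex number other than $0$ and $1$ is of the form $e^m$ with such an $m$; for $|\operatorname{Im} m|>2\pi$ the integral below diverges.) Then the integral $$\int_0^\infty (1-\coth \pi x)\left(e^{imx}(1+ix)^k-e^{-imx}(1-ix)^k\right)dx$$ converges absolutely and $$\mathrm{Li}_{-k}(e^m)=\frac{e^m}{2}+(-m)^{-k-1}\,\Gamma(k+1,-m)-\frac{i e^m}{2}\int_0^\infty (1-\coth \pi x)\left(e^{imx}(1+ix)^k-e^{-imx}(1-ix)^k\right)dx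 ,$$ where all powers are principal values ($\arg\in(-\pi,\pi]$). -/

import Mathlib

/-- `F` is a holomorphic function on the cut plane `ℂ \ [1, ∞)` (that is, `1 - z` is not in
`(-∞, 0]`) which on the open unit disc is given by the polylogarithm series
`∑_{n ≥ 1} z ^ n / n ^ s`. As the cut plane is open and connected, `F` is unique there. -/
def IsPolylogBranch (s : ℂ) (F : ℂ → ℂ) : Prop :=
  DifferentiableOn ℂ F {z : ℂ | 1 - z ∈ Complex.slitPlane} ∧
    ∀ z : ℂ, ‖z‖ < 1 →
      HasSum (fun n : ℕ => z ^ (n + 1) / ((n + 1 : ℕ) : ℂ) ^ s) (F z)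

/-- A function that continues the polylogarithm series of order `s` to `ℂ \ [1, ∞)`. -/
noncomputable def polylogBranch (s : ℂ) : ℂ → ℂ :=
  Classical.epsilon (IsPolylogBranch s)

open Classical in
/-- The principal value of the polylogarithm `Li_s(z)`: the analytic continuation of
`∑_{n ≥ 1} z ^ n / n ^ s` to `ℂ \ [1, ∞)` and, on the cut `[1, ∞)`, the limit from the lower
half-plane (the usual convention). -/
noncomputable def polylog (s z : ℂ) : ℂ :=
  if 1 - z ∈ Complex.slitPlane then polylogBranch s z
  else Filter.limUnder (nhdsWithin z {w : ℂ | w.im < 0}) (polylogBranch s)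

open Classical in
/-- The principal value of the upper incomplete gamma function
`Γ(a, z) = ∫_z^∞ t ^ (a - 1) e ^ (-t) dt`, where the path from `z` to infinity does not cross
`(-∞, 0]` and `t ^ (a - 1)` has its principal value. The path is the ray `t = z + c u`, `u > 0`,
with `c = 1` if `z ∉ (-∞, 0]`. For `z ∈ (-∞, 0]`, where `arg z = π` if `z ≠ 0`,
it leaves `z` into the upper half-plane, with `c = 1 + i`. -/
noncomputable def upperIncompleteGamma (a z : ℂ) : ℂ :=
  let c : ℂ := if z ∈ Complex.slitPlane then 1 else 1 + Complex.I
  ∫ u in Set.Ioi (0 : ℝ), (z + c * u) ^ (a - 1) * Complex.exp (-(z + c * u)) * c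

/-- The integrand
`(1 - coth (π x)) (e ^ (i m x) (1 + i x) ^ k - e ^ (-i m x) (1 - i x) ^ k)`. -/
noncomputable def polylogIntegrand (k m : ℂ) (x : ℝ) : ℂ :=
  (1 - ((Real.cosh (Real.pi * x) / Real.sinh (Real.pi * x) : ℝ) : ℂ)) *
    (Complex.exp (Complex.I * m * x) * (1 + Complex.I * x) ^ k -
      Complex.exp (-(Complex.I * m * x)) * (1 - Complex.I * x) ^ k)

/-! Put `k = -a` and `m = -A` with `Re a > 0` and `A > 0`. Euler's integral writes `Γ(a) (1 ±
ix)^(-a) e^(∓iAx)` as an integral of `s^(a-1) e^(-s)` against `e^(∓i(s+A)x)`, so the difference in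
the integrand becomes `-2i sin((s+A)x)`. The sine transform of `1 - coth πx` at `b = s + A` is `1/2
+ 1/b - 1/(1 - e^(-b))`, by the partial fractions of the cotangent. After Fubini the constant `1/2`
cancels `e^m/2`, the term `1/b` cancels the incomplete gamma function, and the geometric series of
the last term is the polylogarithm series (`hasSum_polylogFormula_neg`).

The other parameters follow by two continuations. Both sides obey `d/dm F_k = F_{k+1}`
(`hasDerivAt_polylogFormula`, `hasDerivAt_polylogSeries_exp`), so differentiating the identity
raises `Re k` step by step. In `m`, the identity theorem extends it from the negative axis to `Re m
< 0` in the strip.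

For larger `m` the continuation of the series has to be shown to exist. The formula takes equal
values at points of the strip with equal exponential (`polylogFormula_eq_of_exp_eq`), hence descends
to a holomorphic function of `z = e^m` off `[1, ∞)`. On the cut both sides are limits from below in
`m`, that is, from above in `-m`, the side from which `Γ(k+1, ·)` and the principal power are
continuous. -/

section

open Complex MeasureTheory Filter Topology Set

/-! ### Growth of powers and the incomplete gamma function. -/

/-- Away from the origin a complex power grows more slowly than any exponential. -/
theorem norm_cpow_le_exp (b : ℂ) {δ ε : ℝ} (hδ : 0 < δ) (hε : 0 < ε) :
    ∃ C : ℝ, 0 < C ∧ ∀ w : ℂ, δ ≤ ‖w‖ → ‖w ^ b‖ ≤ C * Real.exp (ε * ‖w‖) := by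
  -- Chosen so that `|Re b| η ≤ ε`; the `+ 1` covers `Re b = 0`.
  set η : ℝ := ε / (|b.re| + 1) with hη
  have hb : 0 < |b.re| + 1 := by positivity
  have hη0 : 0 < η := by positivity
  set K : ℝ := |Real.log η| + |Real.log δ| with hK
  refine ⟨Real.exp (|b.re| * K + Real.pi * |b.im|), Real.exp_pos _, fun w hw => ?_⟩
  have hw0 : 0 < ‖w‖ := hδ.trans_le hw
  have hwne : w ≠ 0 := norm_pos_iff.mp hw0
  rw [cpow_def_of_ne_zero hwne, norm_exp, ← Real.exp_add, Real.exp_le_exp]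
  have hre : (log w * b).re = Real.log ‖w‖ * b.re - arg w * b.im := by
    simp [mul_re, log_re, log_im]
  have hlog : |Real.log ‖w‖| ≤ η * ‖w‖ + K := by
    have h1 : Real.log ‖w‖ ≤ η * ‖w‖ + K := by
      have := Real.log_le_sub_one_of_pos (mul_pos hη0 hw0)
      rw [Real.log_mul hη0.ne' hw0.ne'] at this
      have h2 := neg_abs_le (Real.log η)
      have h3 := abs_nonneg (Real.log δ)
      linarith
    have h2 : -(η * ‖w‖ + K) ≤ Real.log ‖w‖ := by
      have := Real.log_le_log hδ hw
      have h2 := neg_abs_le (Real.log δ)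
      have h3 := abs_nonneg (Real.log η)
      have : 0 ≤ η * ‖w‖ := by positivity
      linarith
    exact abs_le.mpr ⟨h2, h1⟩
  have h1 : Real.log ‖w‖ * b.re ≤ |b.re| * (η * ‖w‖ + K) := by
    calc Real.log ‖w‖ * b.re ≤ |Real.log ‖w‖ * b.re| := le_abs_self _
      _ = |b.re| * |Real.log ‖w‖| := by rw [abs_mul, mul_comm]
      _ ≤ _ := by gcongr
  have h2 : -(arg w * b.im) ≤ Real.pi * |b.im| := by
    calc -(arg w * b.im) ≤ |arg w * b.im| := neg_le_abs _
      _ = |arg w| * |b.im| := abs_mul _ _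
      _ ≤ _ := by gcongr; exact abs_arg_le_pi w
  have h3 : |b.re| * (η * ‖w‖) ≤ ε * ‖w‖ := by
    rw [← mul_assoc]
    gcongr
    rw [hη, mul_div_assoc', div_le_iff₀ hb]
    nlinarith [abs_nonneg b.re]
  rw [hre]
  nlinarith

theorem integrableOn_const_mul_exp_neg (C : ℝ) {c : ℝ} (hc : 0 < c) :
    IntegrableOn (fun u : ℝ => C * Real.exp (-c * u)) (Ioi 0) :=
  (exp_neg_integrableOn_Ioi 0 hc).const_mul C

/-- The integrand `w ^ (a - 1) e ^ (-w)` of the incomplete gamma function. -/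
noncomputable def gammaIntegrand (a w : ℂ) : ℂ := w ^ (a - 1) * exp (-w)

/-- The hypotheses fit both horizontal rays and rays in direction `1 + i`, with `t` the parameter.
The power costs at most `e^(‖w‖/4) ≤ e^(R/4 + t/2)` and the exponential gains `e^(R - t)`, which
leaves `e^(-t/2)`. -/
theorem gammaIntegrand_bound (a : ℂ) {δ : ℝ} (hδ : 0 < δ) (R : ℝ) :
    ∃ C : ℝ, 0 < C ∧ ∀ (w : ℂ) (t : ℝ), δ ≤ ‖w‖ → ‖w‖ ≤ R + 2 * t → t - R ≤ w.re →
      ‖gammaIntegrand a w‖ ≤ C * Real.exp (-(1 / 2) * t) := by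
  obtain ⟨C, hC, h⟩ := norm_cpow_le_exp (a - 1) hδ (show (0 : ℝ) < 1 / 4 by norm_num)
  refine ⟨C * Real.exp (2 * |R|), by positivity, fun w t h1 h2 h3 => ?_⟩
  rw [gammaIntegrand, norm_mul, norm_exp]
  calc ‖w ^ (a - 1)‖ * Real.exp (-w).re
      ≤ (C * Real.exp (1 / 4 * ‖w‖)) * Real.exp (-w).re := by gcongr; exact h w h1
    _ = C * Real.exp (1 / 4 * ‖w‖ + (-w).re) := by rw [mul_assoc, Real.exp_add]
    _ ≤ C * Real.exp (2 * |R| + -(1 / 2) * t) := by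
        refine mul_le_mul_of_nonneg_left (Real.exp_le_exp.mpr ?_) hC.le
        have := le_abs_self R
        have := abs_nonneg R
        rw [Complex.neg_re]
        linarith
    _ = _ := by rw [Real.exp_add, mul_assoc]

theorem hasDerivAt_gammaIntegrand (a : ℂ) {w : ℂ} (hw : w ∈ slitPlane) :
    HasDerivAt (gammaIntegrand a) ((a - 1) * gammaIntegrand (a - 1) w - gammaIntegrand a w) w := by
  have h1 := (hasDerivAt_id' w).cpow_const (c := a - 1) hw
  have h2 := (hasDerivAt_neg' w).cexp
  refine (h1.fun_mul h2).congr_deriv ?_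
  simp only [gammaIntegrand]
  ring

theorem measurable_gammaIntegrand (a : ℂ) : Measurable (gammaIntegrand a) := by
  unfold gammaIntegrand
  fun_prop

/-- Rays to the right that start near a point of the slit plane stay away from the origin. -/
theorem exists_ball_add_mem_slitPlane {z₀ : ℂ} (hz : z₀ ∈ slitPlane) :
    ∃ δ : ℝ, 0 < δ ∧ ∀ z ∈ Metric.ball z₀ δ, ∀ u : ℝ, 0 ≤ u →
      δ ≤ ‖z + u‖ ∧ z + u ∈ slitPlane := by
  rcases hz with h | h
  · refine ⟨z₀.re / 2, by positivity, fun z hz u hu => ?_⟩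
    have h1 := (abs_re_le_norm (z - z₀)).trans_lt (by simpa [dist_eq_norm] using hz)
    rw [sub_re, abs_lt] at h1
    have h2 : (z + u).re = z.re + u := by simp
    refine ⟨le_trans (by linarith) ((le_abs_self _).trans (abs_re_le_norm (z + u))), Or.inl ?_⟩
    linarith
  · have h0 : 0 < |z₀.im| := abs_pos.mpr h
    refine ⟨|z₀.im| / 2, by positivity, fun z hz u hu => ?_⟩
    have h1 := (abs_im_le_norm (z - z₀)).trans_lt (by simpa [dist_eq_norm] using hz)
    have h2 : (z + u).im = z.im := by simp
    have h3 : |z₀.im| ≤ |z.im| + |(z - z₀).im| := by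
      rw [sub_im]
      have := abs_sub_abs_le_abs_sub z₀.im z.im
      rw [abs_sub_comm] at this
      linarith
    have h4 : |z₀.im| / 2 ≤ |z.im| := by linarith
    refine ⟨?_, Or.inr ?_⟩
    · refine le_trans ?_ (abs_im_le_norm (z + u))
      rwa [h2]
    · rw [h2]
      exact abs_pos.mp (by linarith)

theorem upperIncompleteGamma_eq_of_mem_slitPlane (a : ℂ) {z : ℂ} (hz : z ∈ slitPlane) :
    upperIncompleteGamma a z = ∫ u in Ioi (0 : ℝ), gammaIntegrand a (z + u) := by
  simp [upperIncompleteGamma, hz, gammaIntegrand]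

/-- A uniform exponential bound for the integrand on the rays `z + u`, `u > 0`. -/
theorem gammaIntegrand_ray_bound (a : ℂ) {z₀ : ℂ} (hz : z₀ ∈ slitPlane) :
    ∃ δ C : ℝ, 0 < δ ∧ 0 < C ∧ ∀ z ∈ Metric.ball z₀ δ, ∀ u : ℝ, 0 ≤ u →
      z + u ∈ slitPlane ∧ ‖gammaIntegrand a (z + u)‖ ≤ C * Real.exp (-(1 / 2) * u) := by
  obtain ⟨δ, hδ, h⟩ := exists_ball_add_mem_slitPlane hz
  obtain ⟨C, hC, hb⟩ := gammaIntegrand_bound a hδ (‖z₀‖ + δ)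
  refine ⟨δ, C, hδ, hC, fun z hzz u hu => ⟨(h z hzz u hu).2, hb _ u (h z hzz u hu).1 ?_ ?_⟩⟩
  all_goals
    have h1 : ‖z‖ ≤ ‖z₀‖ + δ := by
      have : ‖z - z₀‖ < δ := by simpa [dist_eq_norm] using hzz
      have := norm_add_le z₀ (z - z₀)
      rw [add_sub_cancel] at this
      linarith
  · have := norm_add_le z (u : ℂ)
    rw [Complex.norm_of_nonneg hu] at this
    linarith
  · have := (abs_le.mp (abs_re_le_norm z)).1
    simp only [add_re, ofReal_re]
    linarith

theorem integrableOn_gammaIntegrand_ray (a : ℂ) {z : ℂ} (hz : z ∈ slitPlane) :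
    IntegrableOn (fun u : ℝ => gammaIntegrand a (z + u)) (Ioi 0) := by
  obtain ⟨δ, C, hδ, hC, h⟩ := gammaIntegrand_ray_bound a hz
  refine (integrableOn_const_mul_exp_neg C (c := 1 / 2) (by norm_num)).mono' ?_ ?_
  · exact ((measurable_gammaIntegrand a).comp (by fun_prop)).aestronglyMeasurable
  · filter_upwards [ae_restrict_mem measurableSet_Ioi] with u hu
    exact (h z (Metric.mem_ball_self hδ) u (le_of_lt hu)).2

theorem tendsto_const_mul_exp_neg (C : ℝ) {c : ℝ} (hc : 0 < c) :
    Tendsto (fun u : ℝ => C * Real.exp (-c * u)) atTop (𝓝 0) := by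
  have : Tendsto (fun u : ℝ => -c * u) atTop atBot :=
    tendsto_id.const_mul_atTop_of_neg (by linarith)
  simpa using (Real.tendsto_exp_atBot.comp this).const_mul C

/-- The fundamental theorem of calculus along the ray. It yields both the recurrence in `a` and the
derivative in `z`. -/
theorem integral_deriv_gammaIntegrand_ray (a : ℂ) {z : ℂ} (hz : z ∈ slitPlane) :
    ∫ u in Ioi (0 : ℝ), ((a - 1) * gammaIntegrand (a - 1) (z + u) - gammaIntegrand a (z + u)) =
      -gammaIntegrand a z := by
  obtain ⟨δ, C, hδ, hC, h⟩ := gammaIntegrand_ray_bound a hz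
  have hd : ∀ u ∈ Ici (0 : ℝ), HasDerivAt (fun u : ℝ => gammaIntegrand a (z + u))
      ((a - 1) * gammaIntegrand (a - 1) (z + u) - gammaIntegrand a (z + u)) u := by
    intro u hu
    have h1 := hasDerivAt_gammaIntegrand a (h z (Metric.mem_ball_self hδ) u hu).1
    have h2 : HasDerivAt (fun u : ℝ => z + u) 1 u := (ofRealCLM.hasDerivAt (x := u)).const_add z
    simpa [Function.comp_def] using h1.comp_of_eq u h2 rfl
  have := integral_Ioi_of_hasDerivAt_of_tendsto' hd
    (((integrableOn_gammaIntegrand_ray (a - 1) hz).const_mul _).sub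
      (integrableOn_gammaIntegrand_ray a hz)) (m := 0) ?_
  · simpa using this
  · refine squeeze_zero_norm' ?_ (tendsto_const_mul_exp_neg C (c := 1 / 2) (by norm_num))
    filter_upwards [eventually_ge_atTop 0] with u hu
    exact (h z (Metric.mem_ball_self hδ) u hu).2

/-- The recurrence `Γ(a, z) = (a - 1) Γ(a - 1, z) + z ^ (a - 1) e ^ (-z)`. -/
theorem upperIncompleteGamma_recurrence (a : ℂ) {z : ℂ} (hz : z ∈ slitPlane) :
    upperIncompleteGamma a z =
      (a - 1) * upperIncompleteGamma (a - 1) z + gammaIntegrand a z := by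
  have h := integral_deriv_gammaIntegrand_ray a hz
  rw [integral_sub ((integrableOn_gammaIntegrand_ray (a - 1) hz).const_mul _)
      (integrableOn_gammaIntegrand_ray a hz), integral_const_mul] at h
  rw [upperIncompleteGamma_eq_of_mem_slitPlane a hz,
    upperIncompleteGamma_eq_of_mem_slitPlane (a - 1) hz]
  linear_combination -h

theorem hasDerivAt_upperIncompleteGamma (a : ℂ) {z₀ : ℂ} (hz : z₀ ∈ slitPlane) :
    HasDerivAt (upperIncompleteGamma a) (-gammaIntegrand a z₀) z₀ := by
  obtain ⟨δ, C, hδ, hC, h⟩ := gammaIntegrand_ray_bound a hz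
  obtain ⟨δ', C', hδ', hC', h'⟩ := gammaIntegrand_ray_bound (a - 1) hz
  -- The integrand depends on `z + u` only, so its `z`-derivative is its `u`-derivative and
  -- integrates to a boundary term.
  have key := (hasDerivAt_integral_of_dominated_loc_of_deriv_le
    (μ := volume.restrict (Ioi (0 : ℝ))) (x₀ := z₀) (s := Metric.ball z₀ (min δ δ'))
    (F := fun z u => gammaIntegrand a (z + (u : ℝ)))
    (F' := fun z u => (a - 1) * gammaIntegrand (a - 1) (z + (u : ℝ)) - gammaIntegrand a (z + u))
    (bound := fun u => (‖a - 1‖ * C' + C) * Real.exp (-(1 / 2) * u))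
    (Metric.ball_mem_nhds _ (lt_min hδ hδ')) ?_ (integrableOn_gammaIntegrand_ray a hz) ?_ ?_
    (integrableOn_const_mul_exp_neg _ (by norm_num)) ?_).2
  · rw [integral_deriv_gammaIntegrand_ray a hz] at key
    refine key.congr_of_eventuallyEq ?_
    filter_upwards [isOpen_slitPlane.mem_nhds hz] with z hz
    exact upperIncompleteGamma_eq_of_mem_slitPlane a hz
  · exact Eventually.of_forall fun z =>
      ((measurable_gammaIntegrand a).comp (by fun_prop)).aestronglyMeasurable
  · refine (Measurable.sub (Measurable.const_mul ?_ _) ?_).aestronglyMeasurable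
    · exact (measurable_gammaIntegrand (a - 1)).comp (by fun_prop)
    · exact (measurable_gammaIntegrand a).comp (by fun_prop)
  · filter_upwards [ae_restrict_mem measurableSet_Ioi] with u hu z hzz
    refine (norm_sub_le _ _).trans ?_
    rw [norm_mul, add_mul, mul_assoc]
    gcongr
    · exact (h' z (Metric.ball_subset_ball (min_le_right _ _) hzz) u (le_of_lt hu)).2
    · exact (h z (Metric.ball_subset_ball (min_le_left _ _) hzz) u (le_of_lt hu)).2
  · filter_upwards [ae_restrict_mem measurableSet_Ioi] with u hu z hzz
    exact (hasDerivAt_gammaIntegrand a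
      (h z (Metric.ball_subset_ball (min_le_left _ _) hzz) u (le_of_lt hu)).1).comp_add_const z (u : ℂ)

/-- On the upper half-plane the ray in the definition of `Γ(a, z)` can be turned by `π / 4`. -/
theorem upperIncompleteGamma_eq_tilted (a : ℂ) {z : ℂ} (hz : 0 < z.im) :
    upperIncompleteGamma a z =
      ∫ u in Ioi (0 : ℝ), gammaIntegrand a (z + (1 + I) * u) * (1 + I) := by
  have hslit : ∀ s : ℝ, 0 ≤ s → z + (1 + I) * s ∈ slitPlane := fun s hs => by
    refine Or.inr ?_
    simp
    linarith
  have him : ∀ s : ℝ, 0 ≤ s → ∀ u : ℝ, z.im ≤ ‖z + (1 + I) * s + u‖ := fun s hs u => by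
    refine le_trans ?_ ((le_abs_self _).trans (abs_im_le_norm _))
    simpa using hs
  have hI : ‖(1 + I : ℂ)‖ ≤ 2 := (norm_add_le _ _).trans (by simp; norm_num)
  obtain ⟨C, hC, hb⟩ := gammaIntegrand_bound a hz ‖z‖
  have hbd : ∀ s : ℝ, 0 ≤ s → ∀ u : ℝ, 0 ≤ u →
      ‖gammaIntegrand a (z + (1 + I) * s + u)‖ ≤ C * Real.exp (-(1 / 2) * (s + u)) := by
    intro s hs u hu
    refine hb _ _ (him s hs u) ?_ ?_
    · refine (norm_add_le _ _).trans ?_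
      rw [Complex.norm_of_nonneg hu]
      have := norm_add_le z ((1 + I) * s)
      rw [norm_mul, Complex.norm_of_nonneg hs] at this
      nlinarith
    · have := (abs_le.mp (abs_re_le_norm z)).1
      simp
      linarith
  have hint : IntegrableOn (fun s : ℝ => gammaIntegrand a (z + (1 + I) * s)) (Ioi 0) := by
    refine (integrableOn_const_mul_exp_neg C (c := 1 / 2) (by norm_num)).mono' ?_ ?_
    · exact ((measurable_gammaIntegrand a).comp (by fun_prop)).aestronglyMeasurable
    · filter_upwards [ae_restrict_mem measurableSet_Ioi] with u hu
      simpa using hbd u (le_of_lt hu) 0 le_rfl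
  -- In place of Cauchy's theorem: minus the tilted integrand is the derivative of `Γ(a, ·)` along
  -- the tilted ray, where `Γ(a, ·)` tends to `0`.
  have hd : ∀ s ∈ Ici (0 : ℝ), HasDerivAt
      (fun s : ℝ => upperIncompleteGamma a (z + (1 + I) * s))
      (-(gammaIntegrand a (z + (1 + I) * s) * (1 + I))) s := by
    intro s hs
    have h2 : HasDerivAt (fun s : ℝ => z + (1 + I) * s) (1 + I) s := by
      simpa using ((ofRealCLM.hasDerivAt (x := s)).const_mul (1 + I)).const_add z
    simpa [Function.comp_def] using
      (hasDerivAt_upperIncompleteGamma a (hslit s hs)).comp_of_eq s h2 rfl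
  have hlim : Tendsto (fun s : ℝ => upperIncompleteGamma a (z + (1 + I) * s)) atTop (𝓝 0) := by
    refine squeeze_zero_norm' ?_
      (tendsto_const_mul_exp_neg (C * 2) (c := 1 / 2) (by norm_num))
    filter_upwards [eventually_ge_atTop 0] with s hs
    rw [upperIncompleteGamma_eq_of_mem_slitPlane a (hslit s hs)]
    have h1 : ∫ u in Ioi (0 : ℝ), C * Real.exp (-(1 / 2) * s) * Real.exp (-(1 / 2) * u) =
        C * 2 * Real.exp (-(1 / 2) * s) := by
      rw [integral_const_mul, integral_exp_mul_Ioi (by norm_num)]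
      norm_num
      ring
    rw [← h1]
    refine norm_integral_le_of_norm_le (integrableOn_const_mul_exp_neg _ (by norm_num)) ?_
    filter_upwards [ae_restrict_mem measurableSet_Ioi] with u hu
    refine (hbd s hs u (le_of_lt hu)).trans_eq ?_
    rw [mul_assoc, ← Real.exp_add, mul_add]
  have := integral_Ioi_of_hasDerivAt_of_tendsto' hd ((hint.mul_const _).neg) hlim
  rw [integral_neg] at this
  simpa using this.symm

/-- On the cut `Γ(a, ·)` is continuous from above. -/
theorem tendsto_upperIncompleteGamma_of_neg (a : ℂ) {z₀ : ℂ} (him : z₀.im = 0) (hre : z₀.re < 0) :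
    Tendsto (upperIncompleteGamma a) (𝓝[{z : ℂ | 0 < z.im}] z₀) (𝓝 (upperIncompleteGamma a z₀)) := by
  have hz₀ : z₀ ∉ slitPlane := by
    simp [mem_slitPlane_iff, him, hre.le]
  have hdef : upperIncompleteGamma a z₀ =
      ∫ u in Ioi (0 : ℝ), gammaIntegrand a (z₀ + (1 + I) * u) * (1 + I) := by
    simp [upperIncompleteGamma, hz₀, gammaIntegrand]
  have hI : ‖(1 + I : ℂ)‖ ≤ 2 := (norm_add_le _ _).trans (by simp; norm_num)
  -- The tilted ray from `z₀` keeps distance `2δ` from the origin, as `u` and `u - 4δ` cannot both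
  -- be smaller than `2δ` in absolute value. Starting points within `δ` of `z₀` then keep distance
  -- `δ`.
  set δ : ℝ := -z₀.re / 4 with hδ
  have hδ0 : 0 < δ := by linarith
  have hlow : ∀ u : ℝ, 2 * δ ≤ ‖z₀ + (1 + I) * u‖ := by
    intro u
    have h1 : (z₀ + (1 + I) * u).re = z₀.re + u := by simp
    have h2 : (z₀ + (1 + I) * u).im = u := by simp [him]
    by_contra hcon
    push Not at hcon
    have h3 := abs_lt.mp ((abs_re_le_norm _).trans_lt hcon)
    have h4 := abs_lt.mp ((abs_im_le_norm _).trans_lt hcon)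
    rw [h1] at h3
    rw [h2] at h4
    linarith
  obtain ⟨C, hC, hb⟩ := gammaIntegrand_bound a hδ0 (‖z₀‖ + δ)
  have hbd : ∀ z ∈ Metric.ball z₀ δ, ∀ u : ℝ, 0 ≤ u →
      ‖gammaIntegrand a (z + (1 + I) * u)‖ ≤ C * Real.exp (-(1 / 2) * u) := by
    intro z hz u hu
    have hz' : ‖z - z₀‖ < δ := by simpa [dist_eq_norm] using hz
    have h1 : ‖z‖ ≤ ‖z₀‖ + δ := by
      have := norm_add_le z₀ (z - z₀)
      rw [add_sub_cancel] at this
      linarith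
    refine hb _ _ ?_ ?_ ?_
    · have h2 := norm_sub_le (z + (1 + I) * u) (z - z₀)
      have h3 : z + (1 + I) * u - (z - z₀) = z₀ + (1 + I) * u := by ring
      rw [h3] at h2
      have := hlow u
      linarith
    · have := norm_add_le z ((1 + I) * u)
      rw [norm_mul, Complex.norm_of_nonneg hu] at this
      nlinarith
    · have := (abs_le.mp (abs_re_le_norm z)).1
      simp
      linarith
  rw [hdef]
  have hev : ∀ᶠ z in 𝓝[{z : ℂ | 0 < z.im}] z₀, upperIncompleteGamma a z =
      ∫ u in Ioi (0 : ℝ), gammaIntegrand a (z + (1 + I) * u) * (1 + I) := by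
    filter_upwards [self_mem_nhdsWithin] with z hz using upperIncompleteGamma_eq_tilted a hz
  refine Tendsto.congr' (hev.mono fun _ h => h.symm) ?_
  refine tendsto_integral_filter_of_dominated_convergence
    (fun u => C * 2 * Real.exp (-(1 / 2) * u)) ?_ ?_
    (integrableOn_const_mul_exp_neg _ (by norm_num)) ?_
  · exact Eventually.of_forall fun z =>
      (((measurable_gammaIntegrand a).comp (by fun_prop)).mul_const _).aestronglyMeasurable
  · filter_upwards [nhdsWithin_le_nhds (Metric.ball_mem_nhds z₀ hδ0)] with z hz
    filter_upwards [ae_restrict_mem measurableSet_Ioi] with u hu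
    rw [norm_mul, mul_right_comm]
    gcongr
    exact hbd z hz u (le_of_lt hu)
  · filter_upwards [ae_restrict_mem measurableSet_Ioi] with u hu
    have h1 : z₀ + (1 + I) * u ∈ slitPlane := by
      refine Or.inr ?_
      have : (z₀ + (1 + I) * u).im = u := by simp [him]
      rw [this]
      exact ne_of_gt hu
    have h2 : Tendsto (fun z : ℂ => z + (1 + I) * u) (𝓝[{z : ℂ | 0 < z.im}] z₀)
        (𝓝 (z₀ + (1 + I) * u)) :=
      ((continuous_id.add continuous_const).tendsto z₀).mono_left nhdsWithin_le_nhds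
    exact ((hasDerivAt_gammaIntegrand a h1).continuousAt.tendsto.comp h2).mul_const _

/-! ### The kernel and its decay. -/

/-- The kernel `1 - coth (π x)`. -/
noncomputable def cothKernel (x : ℝ) : ℝ :=
  1 - Real.cosh (Real.pi * x) / Real.sinh (Real.pi * x)

theorem cothKernel_eq {x : ℝ} (hx : 0 < x) :
    cothKernel x = -2 * (Real.exp (-(2 * Real.pi * x)) / (1 - Real.exp (-(2 * Real.pi * x)))) := by
  have hy : 0 < Real.pi * x := by positivity
  have hs : 0 < Real.sinh (Real.pi * x) := Real.sinh_pos_iff.mpr hy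
  have he : Real.exp (-(2 * Real.pi * x)) = Real.exp (-(Real.pi * x)) * Real.exp (-(Real.pi * x)) := by
    rw [← Real.exp_add]; ring_nf
  have h1 : Real.exp (Real.pi * x) * Real.exp (-(Real.pi * x)) = 1 := by
    rw [← Real.exp_add]; simp
  have h2 : 0 < 1 - Real.exp (-(2 * Real.pi * x)) := by
    rw [sub_pos, Real.exp_lt_one_iff]; linarith
  have h3 : 1 - Real.exp (-(2 * Real.pi * x)) =
      2 * Real.sinh (Real.pi * x) * Real.exp (-(Real.pi * x)) := by
    rw [he, Real.sinh_eq]; linear_combination -h1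
  have h4 := Real.cosh_sub_sinh (Real.pi * x)
  rw [cothKernel, h3, he]
  field_simp
  linarith

/-- The factor `x` removes the simple pole at `0`. With `E = e^(-2πx)` the claim is `x ≤ (1 + x)(1 -
E)`, which follows from `(1 + 2πx) E ≤ 1`. -/
theorem abs_cothKernel_mul_le {x : ℝ} (hx : 0 < x) :
    |cothKernel x| * x ≤ 2 * (1 + x) * Real.exp (-(2 * Real.pi * x)) := by
  have hpi := Real.pi_gt_three
  have hy : 0 < 2 * Real.pi * x := by positivity
  set E := Real.exp (-(2 * Real.pi * x)) with hE
  have hE0 : 0 < E := Real.exp_pos _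
  have h2 : 0 < 1 - E := by
    rw [sub_pos, hE, Real.exp_lt_one_iff]; linarith
  have h3 : (1 + 2 * Real.pi * x) * E ≤ 1 := by
    have := Real.add_one_le_exp (2 * Real.pi * x)
    calc (1 + 2 * Real.pi * x) * E ≤ Real.exp (2 * Real.pi * x) * E := by gcongr; linarith
      _ = 1 := by rw [hE, ← Real.exp_add]; simp
  rw [cothKernel_eq hx, abs_mul, abs_of_nonneg (div_nonneg hE0.le h2.le)]
  have h4 : x ≤ (1 + x) * (1 - E) := by
    have h5 : E * (1 + x) ≤ E * (1 + 2 * Real.pi * x) := by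
      gcongr; nlinarith
    nlinarith
  have h6 : E / (1 - E) * x ≤ (1 + x) * E := by
    rw [div_mul_eq_mul_div, div_le_iff₀ h2]
    nlinarith
  norm_num
  linarith

theorem measurable_cothKernel : Measurable cothKernel := by
  unfold cothKernel
  fun_prop

theorem exists_abs_cothKernel_mul_le {c : ℝ} (hc : c < 2 * Real.pi) :
    ∃ C : ℝ, 0 < C ∧ ∀ x : ℝ, 0 < x → |cothKernel x| * x ≤ C * Real.exp (-c * x) := by
  set ε := 2 * Real.pi - c with hε
  have hε0 : 0 < ε := by linarith
  refine ⟨2 * (1 + 1 / ε), by positivity, fun x hx => (abs_cothKernel_mul_le hx).trans ?_⟩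
  have h1 : 1 + x ≤ (1 + 1 / ε) * Real.exp (ε * x) := by
    have h2 := Real.add_one_le_exp (ε * x)
    have h3 : 0 ≤ ε * x := by positivity
    have h4 : 1 / ε * (ε * x) = x := by field_simp
    have h5 : 1 / ε * (ε * x) ≤ 1 / ε * Real.exp (ε * x) := by gcongr; linarith
    nlinarith
  calc 2 * (1 + x) * Real.exp (-(2 * Real.pi * x))
      ≤ 2 * ((1 + 1 / ε) * Real.exp (ε * x)) * Real.exp (-(2 * Real.pi * x)) := by gcongr
    _ = 2 * (1 + 1 / ε) * (Real.exp (ε * x) * Real.exp (-(2 * Real.pi * x))) := by ring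
    _ = 2 * (1 + 1 / ε) * Real.exp (-c * x) := by
        rw [← Real.exp_add]; congr 2; rw [hε]; ring

/-! ### Convergence of the integral and its derivative in `m`. -/

/-- The function `t ^ k e ^ (m t)` on the vertical line through `1`, normalised at `1`. -/
noncomputable def rotatedPow (σ k m : ℂ) (x : ℝ) : ℂ := exp (σ * m * x) * (1 + σ * x) ^ k

theorem polylogIntegrand_eq (k m : ℂ) (x : ℝ) :
    polylogIntegrand k m x = (cothKernel x : ℂ) * (rotatedPow I k m x - rotatedPow (-I) k m x) := by
  simp only [polylogIntegrand, cothKernel, rotatedPow]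
  push_cast
  congr 3
  · ring_nf
  · congr 1; ring

theorem one_add_mul_mem_slitPlane {σ : ℂ} (hσ : σ.re = 0) (x : ℝ) : 1 + σ * x ∈ slitPlane := by
  left; simp [hσ]

theorem rotatedPow_add_one {σ : ℂ} (hσ : σ.re = 0) (k m : ℂ) (x : ℝ) :
    rotatedPow σ (k + 1) m x = (1 + σ * x) * rotatedPow σ k m x := by
  rw [rotatedPow, rotatedPow, cpow_add _ _ (slitPlane_ne_zero (one_add_mul_mem_slitPlane hσ x)),
    cpow_one]
  ring

/-- Here `σ` stands for `±i`. The constant is uniform in `m`, as differentiation under the integral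
sign requires. -/
theorem exists_norm_rotatedPow_le (k : ℂ) {ε : ℝ} (hε : 0 < ε) :
    ∃ C : ℝ, 0 < C ∧ ∀ σ : ℂ, σ.re = 0 → |σ.im| = 1 → ∀ (m : ℂ) (x : ℝ), 0 ≤ x →
      ‖rotatedPow σ k m x‖ ≤ C * Real.exp ((|m.im| + ε) * x) := by
  obtain ⟨C, hC, h⟩ := norm_cpow_le_exp k one_pos hε
  refine ⟨C * Real.exp ε, by positivity, fun σ hσ hσ' m x hx => ?_⟩
  have h1 : 1 ≤ ‖1 + σ * x‖ := by
    have := (le_abs_self _).trans (abs_re_le_norm (1 + σ * x))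
    simpa [hσ] using this
  have hn : ‖σ‖ ≤ 1 := by
    have := norm_le_abs_re_add_abs_im σ
    rw [hσ, hσ'] at this
    simpa using this
  have h2 : ‖1 + σ * x‖ ≤ 1 + x := by
    refine (norm_add_le _ _).trans ?_
    rw [norm_mul, Complex.norm_of_nonneg hx, norm_one]
    nlinarith
  have h3 : (σ * m * x).re ≤ |m.im| * x := by
    have : (σ * m * x).re = -(σ.im * m.im) * x := by simp [mul_re, hσ]
    rw [this]
    gcongr
    refine (neg_le_abs _).trans ?_
    rw [abs_mul, hσ', one_mul]
  rw [rotatedPow, norm_mul, norm_exp]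
  calc Real.exp (σ * m * x).re * ‖(1 + σ * x) ^ k‖
      ≤ Real.exp (|m.im| * x) * (C * Real.exp (ε * (1 + x))) := by
        gcongr
        exact (h _ h1).trans (by gcongr)
    _ = C * Real.exp ε * Real.exp ((|m.im| + ε) * x) := by
        rw [mul_add ε, add_mul, Real.exp_add, Real.exp_add]; simp only [mul_one]; ring

theorem hasDerivAt_rotatedPow {σ : ℂ} (hσ : σ.re = 0) (k m : ℂ) (x : ℝ) :
    HasDerivAt (rotatedPow σ k m)
      (σ * m * rotatedPow σ k m x + k * σ * rotatedPow σ (k - 1) m x) x := by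
  have h1 : HasDerivAt (fun x : ℝ => exp (σ * m * x)) (exp (σ * m * x) * (σ * m)) x := by
    have := ((ofRealCLM.hasDerivAt (x := x)).const_mul (σ * m)).cexp
    simpa using this
  have h2 : HasDerivAt (fun x : ℝ => 1 + σ * (x : ℂ)) σ x := by
    simpa using ((ofRealCLM.hasDerivAt (x := x)).const_mul σ).const_add 1
  have h3 : HasDerivAt (fun w : ℂ => w ^ k) (k * (1 + σ * x) ^ (k - 1)) (1 + σ * x) := by
    simpa using (hasDerivAt_id' (1 + σ * (x : ℂ))).cpow_const (c := k)
      (one_add_mul_mem_slitPlane hσ x)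
  have h4 : HasDerivAt (fun x : ℝ => (1 + σ * (x : ℂ)) ^ k) (k * (1 + σ * x) ^ (k - 1) * σ) x :=
    h3.comp_of_eq x h2 rfl
  refine (h1.fun_mul h4).congr_deriv ?_
  simp only [rotatedPow]
  ring

/-- Both rotated powers equal `1` at `x = 0`, so by the mean value inequality their difference
vanishes there to first order and cancels the pole of the kernel. -/
theorem exists_norm_rotatedPow_sub_one_le (k m : ℂ) {ε : ℝ} (hε : 0 < ε) :
    ∃ C : ℝ, 0 < C ∧ ∀ σ : ℂ, σ.re = 0 → |σ.im| = 1 → ∀ x : ℝ, 0 ≤ x →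
      ‖rotatedPow σ k m x - 1‖ ≤ C * Real.exp ((|m.im| + ε) * x) * x := by
  obtain ⟨C, hC, h⟩ := exists_norm_rotatedPow_le k hε
  obtain ⟨C', hC', h'⟩ := exists_norm_rotatedPow_le (k - 1) hε
  refine ⟨(‖m‖ * C + ‖k‖ * C') + 1, by positivity, fun σ hσ hσ' x hx => ?_⟩
  have hn : ‖σ‖ ≤ 1 := by
    have := norm_le_abs_re_add_abs_im σ
    rw [hσ, hσ'] at this
    simpa using this
  have key := norm_image_sub_le_of_norm_deriv_le_segment' (a := 0) (b := x)
    (f := rotatedPow σ k m) (C := ((‖m‖ * C + ‖k‖ * C') + 1) * Real.exp ((|m.im| + ε) * x))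
    (fun t _ => (hasDerivAt_rotatedPow hσ k m t).hasDerivWithinAt) ?_ x ⟨hx, le_rfl⟩
  · simpa [rotatedPow] using key
  · intro t ht
    have h1 : ∀ c : ℝ, 0 < c → c * Real.exp ((|m.im| + ε) * t) ≤ c * Real.exp ((|m.im| + ε) * x) :=
      fun c hc => by
        have := ht.2.le
        gcongr
    have e1 := (h σ hσ hσ' m t ht.1).trans (h1 C hC)
    have e2 := (h' σ hσ hσ' m t ht.1).trans (h1 C' hC')
    refine (norm_add_le _ _).trans ?_
    simp only [norm_mul]
    have f1 : ‖σ‖ * ‖m‖ * ‖rotatedPow σ k m t‖ ≤ 1 * ‖m‖ * (C * Real.exp ((|m.im| + ε) * x)) := by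
      gcongr
    have f2 : ‖k‖ * ‖σ‖ * ‖rotatedPow σ (k - 1) m t‖ ≤
        ‖k‖ * 1 * (C' * Real.exp ((|m.im| + ε) * x)) := by
      gcongr
    have := Real.exp_pos ((|m.im| + ε) * x)
    linarith

theorem measurable_rotatedPow (σ k m : ℂ) : Measurable (rotatedPow σ k m) := by
  unfold rotatedPow
  fun_prop

theorem measurable_polylogIntegrand (k m : ℂ) : Measurable (polylogIntegrand k m) := by
  have : polylogIntegrand k m = fun x =>
      (cothKernel x : ℂ) * (rotatedPow I k m x - rotatedPow (-I) k m x) :=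
    funext (polylogIntegrand_eq k m)
  rw [this]
  exact (measurable_ofReal.comp measurable_cothKernel).mul
    ((measurable_rotatedPow _ _ _).sub (measurable_rotatedPow _ _ _))

theorem integrableOn_polylogIntegrand (k : ℂ) {m : ℂ} (hm : |m.im| < 2 * Real.pi) :
    IntegrableOn (polylogIntegrand k m) (Ioi 0) := by
  -- The power grows with rate `|Im m| + ε` and the kernel decays with rate `|Im m| + 2ε < 2π`.
  set ε := (2 * Real.pi - |m.im|) / 4 with hε
  have hε0 : 0 < ε := by linarith
  obtain ⟨C, hC, h⟩ := exists_norm_rotatedPow_sub_one_le k m hε0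
  obtain ⟨K, hK, hq⟩ := exists_abs_cothKernel_mul_le (c := |m.im| + 2 * ε) (by linarith)
  refine (integrableOn_const_mul_exp_neg (2 * C * K) hε0).mono'
    (measurable_polylogIntegrand k m).aestronglyMeasurable ?_
  filter_upwards [ae_restrict_mem measurableSet_Ioi] with x hx
  have hx : 0 < x := hx
  have h1 := h I (by simp) (by simp) x hx.le
  have h2 := h (-I) (by simp) (by simp) x hx.le
  have h3 : ‖rotatedPow I k m x - rotatedPow (-I) k m x‖ ≤
      2 * (C * Real.exp ((|m.im| + ε) * x) * x) := by
    have := norm_sub_le (rotatedPow I k m x - 1) (rotatedPow (-I) k m x - 1)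
    rw [sub_sub_sub_cancel_right] at this
    linarith
  rw [polylogIntegrand_eq, norm_mul, norm_real, Real.norm_eq_abs]
  calc |cothKernel x| * ‖rotatedPow I k m x - rotatedPow (-I) k m x‖
      ≤ |cothKernel x| * (2 * (C * Real.exp ((|m.im| + ε) * x) * x)) := by gcongr
    _ = 2 * C * Real.exp ((|m.im| + ε) * x) * (|cothKernel x| * x) := by ring
    _ ≤ 2 * C * Real.exp ((|m.im| + ε) * x) * (K * Real.exp (-(|m.im| + 2 * ε) * x)) := by
        exact mul_le_mul_of_nonneg_left (hq x hx) (by positivity)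
    _ = 2 * C * K * (Real.exp ((|m.im| + ε) * x) * Real.exp (-(|m.im| + 2 * ε) * x)) := by ring
    _ = 2 * C * K * Real.exp (-ε * x) := by
        rw [← Real.exp_add]; congr 2; ring

theorem hasDerivAt_rotatedPow_param (σ k : ℂ) (x : ℝ) (m : ℂ) :
    HasDerivAt (fun m => rotatedPow σ k m x) (σ * x * rotatedPow σ k m x) m := by
  have h1 : HasDerivAt (fun m : ℂ => σ * m * x) (σ * x) m := by
    simpa using ((hasDerivAt_id' m).const_mul σ).mul_const (x : ℂ)
  refine (h1.cexp.mul_const ((1 + σ * (x : ℂ)) ^ k)).congr_deriv ?_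
  simp only [rotatedPow]
  ring

/-- Raising `k` by one multiplies by `1 + σx`, and `∂/∂m` multiplies by `σx`. Hence this difference
is the `m`-derivative of the integrand. -/
theorem polylogIntegrand_add_one_sub (k m : ℂ) (x : ℝ) :
    polylogIntegrand (k + 1) m x - polylogIntegrand k m x = (cothKernel x : ℂ) *
      (I * x * rotatedPow I k m x - -I * x * rotatedPow (-I) k m x) := by
  rw [polylogIntegrand_eq, polylogIntegrand_eq, rotatedPow_add_one (by simp),
    rotatedPow_add_one (by simp)]
  ring

theorem hasDerivAt_integral_polylogIntegrand (k : ℂ) {m₀ : ℂ} (hm : |m₀.im| < 2 * Real.pi) :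
    HasDerivAt (fun m => ∫ x in Ioi (0 : ℝ), polylogIntegrand k m x)
      ((∫ x in Ioi (0 : ℝ), polylogIntegrand (k + 1) m₀ x) -
        ∫ x in Ioi (0 : ℝ), polylogIntegrand k m₀ x) m₀ := by
  -- One `ε` pays for moving `m` in the ball, one for the power, and the third remains as decay.
  set ε := (2 * Real.pi - |m₀.im|) / 4 with hε
  have hε0 : 0 < ε := by linarith
  obtain ⟨C, hC, h⟩ := exists_norm_rotatedPow_le k hε0
  obtain ⟨K, hK, hq⟩ := exists_abs_cothKernel_mul_le (c := |m₀.im| + 3 * ε) (by linarith)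
  have key := (hasDerivAt_integral_of_dominated_loc_of_deriv_le
    (μ := volume.restrict (Ioi (0 : ℝ))) (x₀ := m₀) (s := Metric.ball m₀ ε)
    (F := fun m x => polylogIntegrand k m x)
    (F' := fun m x => polylogIntegrand (k + 1) m x - polylogIntegrand k m x)
    (bound := fun x => (2 * C * K) * Real.exp (-ε * x))
    (Metric.ball_mem_nhds _ hε0)
    (Eventually.of_forall fun m => (measurable_polylogIntegrand k m).aestronglyMeasurable)
    (integrableOn_polylogIntegrand k hm)
    ((measurable_polylogIntegrand _ _).sub (measurable_polylogIntegrand _ _)).aestronglyMeasurable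
    ?_ (integrableOn_const_mul_exp_neg _ hε0) ?_).2
  · rwa [integral_sub (integrableOn_polylogIntegrand _ hm)
      (integrableOn_polylogIntegrand _ hm)] at key
  · filter_upwards [ae_restrict_mem measurableSet_Ioi] with x hx m hmb
    have hx : 0 < x := hx
    have him : |m.im| ≤ |m₀.im| + ε := by
      have h1 := (abs_im_le_norm (m - m₀)).trans_lt (by simpa [dist_eq_norm] using hmb)
      rw [sub_im] at h1
      have := abs_sub_abs_le_abs_sub m.im m₀.im
      linarith
    have hb : ∀ σ : ℂ, σ.re = 0 → |σ.im| = 1 →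
        ‖rotatedPow σ k m x‖ ≤ C * Real.exp ((|m₀.im| + 2 * ε) * x) := fun σ h1 h2 => by
      refine (h σ h1 h2 m x hx.le).trans ?_
      have : |m.im| + ε ≤ |m₀.im| + 2 * ε := by linarith
      gcongr
    have h1 := hb I (by simp) (by simp)
    have h2 := hb (-I) (by simp) (by simp)
    have h3 : ‖I * x * rotatedPow I k m x - -I * x * rotatedPow (-I) k m x‖ ≤
        x * (2 * C * Real.exp ((|m₀.im| + 2 * ε) * x)) := by
      refine (norm_sub_le _ _).trans ?_
      simp only [norm_mul, norm_neg, norm_I, one_mul, Complex.norm_of_nonneg hx.le]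
      nlinarith
    rw [polylogIntegrand_add_one_sub, norm_mul, norm_real, Real.norm_eq_abs]
    calc |cothKernel x| * ‖I * x * rotatedPow I k m x - -I * x * rotatedPow (-I) k m x‖
        ≤ |cothKernel x| * (x * (2 * C * Real.exp ((|m₀.im| + 2 * ε) * x))) := by gcongr
      _ = 2 * C * Real.exp ((|m₀.im| + 2 * ε) * x) * (|cothKernel x| * x) := by ring
      _ ≤ 2 * C * Real.exp ((|m₀.im| + 2 * ε) * x) * (K * Real.exp (-(|m₀.im| + 3 * ε) * x)) := by
          exact mul_le_mul_of_nonneg_left (hq x hx) (by positivity)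
      _ = 2 * C * K * (Real.exp ((|m₀.im| + 2 * ε) * x) * Real.exp (-(|m₀.im| + 3 * ε) * x)) := by
          ring
      _ = 2 * C * K * Real.exp (-ε * x) := by
          rw [← Real.exp_add]; congr 2; ring
  · refine Eventually.of_forall fun x m _ => ?_
    rw [polylogIntegrand_add_one_sub]
    simp only [polylogIntegrand_eq]
    exact ((hasDerivAt_rotatedPow_param I k x m).fun_sub
      (hasDerivAt_rotatedPow_param (-I) k x m)).const_mul _

/-! ### Identity theorem and Euler's integral with a complex rate. -/

/-- Identity theorem: agreement near a point of the real axis suffices. -/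
theorem eqOn_of_eventuallyEq_ofReal {U : Set ℂ} (hU : IsOpen U) (hc : IsPreconnected U)
    {f g : ℂ → ℂ} (hf : DifferentiableOn ℂ f U) (hg : DifferentiableOn ℂ g U) {x₀ : ℝ}
    (hx : (x₀ : ℂ) ∈ U) (h : ∀ᶠ x : ℝ in 𝓝 x₀, f x = g x) : EqOn f g U := by
  refine (hf.analyticOnNhd hU).eqOn_of_preconnected_of_frequently_eq (hg.analyticOnNhd hU) hc hx ?_
  have h1 : Tendsto (fun x : ℝ => (x : ℂ)) (𝓝[≠] x₀) (𝓝[≠] (x₀ : ℂ)) := by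
    refine tendsto_nhdsWithin_iff.mpr ⟨?_, ?_⟩
    · exact (continuous_ofReal.tendsto x₀).mono_left nhdsWithin_le_nhds
    · filter_upwards [self_mem_nhdsWithin] with x hx
      simpa using hx
  exact h1.frequently (h.filter_mono nhdsWithin_le_nhds).frequently

theorem measurable_cpow_mul_exp_neg_mul (a c : ℂ) :
    Measurable (fun s : ℝ => (s : ℂ) ^ (a - 1) * exp (-(c * s))) := by
  fun_prop

theorem norm_cpow_mul_exp_neg_mul (a c : ℂ) {s : ℝ} (hs : 0 < s) :
    ‖(s : ℂ) ^ (a - 1) * exp (-(c * s))‖ = s ^ (a.re - 1) * Real.exp (-c.re * s) := by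
  rw [norm_mul, norm_cpow_eq_rpow_re_of_pos hs, norm_exp]
  simp

theorem integrableOn_cpow_mul_exp_neg_mul {a c : ℂ} (ha : 0 < a.re) (hc : 0 < c.re) :
    IntegrableOn (fun s : ℝ => (s : ℂ) ^ (a - 1) * exp (-(c * s))) (Ioi 0) := by
  have h := integrableOn_rpow_mul_exp_neg_mul_rpow (s := a.re - 1) (p := 1) (b := c.re)
    (by linarith) one_pos hc
  refine h.mono' (measurable_cpow_mul_exp_neg_mul a c).aestronglyMeasurable ?_
  filter_upwards [ae_restrict_mem measurableSet_Ioi] with s hs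
  rw [norm_cpow_mul_exp_neg_mul a c hs, Real.rpow_one]

theorem ofReal_mul_cpow_sub_one (a : ℂ) {s : ℝ} (hs : 0 < s) :
    (s : ℂ) * (s : ℂ) ^ (a - 1) = (s : ℂ) ^ a := by
  have hs' : (s : ℂ) ≠ 0 := by exact_mod_cast hs.ne'
  rw [cpow_sub _ _ hs', cpow_one]
  field_simp

/-- `∫ s ^ (a - 1) e ^ (-c s) ds = c ^ (-a) Γ(a)` on the right half-plane. -/
theorem integral_cpow_mul_exp_neg_complex_mul {a c : ℂ} (ha : 0 < a.re) (hc : 0 < c.re) :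
    ∫ s in Ioi (0 : ℝ), (s : ℂ) ^ (a - 1) * exp (-(c * s)) = c ^ (-a) * Gamma a := by
  have hopen : IsOpen {c : ℂ | 0 < c.re} := isOpen_lt continuous_const continuous_re
  have hconn : IsPreconnected {c : ℂ | 0 < c.re} := (convex_halfSpace_re_gt 0).isPreconnected
  refine eqOn_of_eventuallyEq_ofReal hopen hconn (x₀ := 1)
    (f := fun c => ∫ s in Ioi (0 : ℝ), (s : ℂ) ^ (a - 1) * exp (-(c * s)))
    (g := fun c => c ^ (-a) * Gamma a) ?_ ?_ (by simp) ?_ hc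
  · intro c₀ hc₀
    have hc₀ : 0 < c₀.re := hc₀
    refine (hasDerivAt_integral_of_dominated_loc_of_deriv_le
      (μ := volume.restrict (Ioi (0 : ℝ))) (x₀ := c₀) (s := Metric.ball c₀ (c₀.re / 2))
      (F := fun c s => (s : ℂ) ^ (a - 1) * exp (-(c * s)))
      (F' := fun c s => -((s : ℂ) * ((s : ℂ) ^ (a - 1) * exp (-(c * s)))))
      (bound := fun s => s ^ a.re * Real.exp (-(c₀.re / 2) * s ^ (1 : ℝ)))
      (Metric.ball_mem_nhds _ (by positivity))
      (Eventually.of_forall fun c => (measurable_cpow_mul_exp_neg_mul a c).aestronglyMeasurable)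
      (integrableOn_cpow_mul_exp_neg_mul ha hc₀)
      (measurable_ofReal.mul (measurable_cpow_mul_exp_neg_mul a c₀)).neg.aestronglyMeasurable
      ?_ (integrableOn_rpow_mul_exp_neg_mul_rpow (by linarith) one_pos (by positivity))
      ?_).2.differentiableAt.differentiableWithinAt
    · filter_upwards [ae_restrict_mem measurableSet_Ioi] with s hs c hcb
      have hs : 0 < s := hs
      have hre : c₀.re / 2 ≤ c.re := by
        have h1 := (abs_re_le_norm (c - c₀)).trans_lt (by simpa [dist_eq_norm] using hcb)
        rw [sub_re, abs_lt] at h1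
        linarith
      rw [norm_neg, ← mul_assoc, ofReal_mul_cpow_sub_one a hs, norm_mul,
        norm_cpow_eq_rpow_re_of_pos hs, norm_exp, Real.rpow_one]
      have : (-(c * s)).re = -c.re * s := by simp
      rw [this]
      have : -c.re ≤ -(c₀.re / 2) := by linarith
      gcongr
    · refine Eventually.of_forall fun s c _ => ?_
      have h1 : HasDerivAt (fun c : ℂ => -(c * s)) (-s) c := by
        simpa using ((hasDerivAt_id' c).mul_const (s : ℂ)).fun_neg
      refine (h1.cexp.const_mul ((s : ℂ) ^ (a - 1))).congr_deriv ?_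
      ring
  · intro c hc
    exact (((hasDerivAt_id' c).cpow_const (c := -a) (Or.inl hc)).mul_const
      _).differentiableAt.differentiableWithinAt
  · filter_upwards [lt_mem_nhds one_pos] with r hr
    rw [integral_cpow_mul_exp_neg_mul_Ioi ha hr, one_div, cpow_neg, inv_cpow]
    rw [arg_ofReal_of_nonneg hr.le]
    exact Real.pi_pos.ne

/-! ### The sine transform of the kernel. -/

theorem hasSum_inv_sq_add {a : ℝ} (ha : 0 < a) :
    HasSum (fun n : ℕ => -2 * (a / (a ^ 2 + (2 * Real.pi * (n + 1)) ^ 2)))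
      (1 / 2 + 1 / a - (1 - Real.exp (-a))⁻¹) := by
  have hpi : (Real.pi : ℂ) ≠ 0 := by exact_mod_cast Real.pi_ne_zero
  have ha' : (a : ℂ) ≠ 0 := by exact_mod_cast ha.ne'
  set z : ℂ := I * a / (2 * Real.pi) with hz
  have hzim : 0 < z.im := by
    have : z = ((a / (2 * Real.pi) : ℝ) : ℂ) * I := by rw [hz]; push_cast; ring
    rw [this, im_ofReal_mul, I_im, mul_one]
    positivity
  have hzmem : z ∈ integerComplement :=
    UpperHalfPlane.coe_mem_integerComplement ⟨z, hzim⟩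
  -- Two expansions of `π cot πz` at `z = ia/2π` are compared: partial fractions, and powers of
  -- `e^(2πiz) = e^(-a)`.
  have h1 := cot_series_rep' hzmem
  have h2 := pi_mul_cot_pi_q_exp ⟨z, hzim⟩
  change Real.pi * cot (Real.pi * z) =
    Real.pi * I - 2 * Real.pi * I * ∑' n : ℕ, exp (2 * Real.pi * I * z) ^ n at h2
  have h3 : 2 * Real.pi * I * z = ((-a : ℝ) : ℂ) := by
    rw [hz]; field_simp; simp
  rw [h3, ← ofReal_exp, tsum_geometric_of_norm_lt_one (by
    rw [norm_real, Real.norm_eq_abs, abs_of_pos (Real.exp_pos _), Real.exp_lt_one_iff]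
    linarith)] at h2
  have hs := (summable_cotTerm hzmem).hasSum
  simp only [cotTerm] at hs
  rw [← h1, h2] at hs
  have hs' := hs.mul_left (1 / (2 * Real.pi * I))
  rw [← Complex.hasSum_ofReal]
  convert! hs' using 1
  · funext n
    have e1 := integerComplement_add_ne_zero hzmem (n + 1)
    have e2 := integerComplement_add_ne_zero hzmem (-(n + 1))
    push_cast at e1 e2
    have e3 : (a : ℂ) ^ 2 + (2 * Real.pi * (n + 1)) ^ 2 ≠ 0 := by
      have : (0 : ℝ) < a ^ 2 + (2 * Real.pi * (n + 1)) ^ 2 := by positivity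
      exact_mod_cast this.ne'
    have e4 : (z - (n + 1)) * (z + (n + 1)) =
        -((a : ℂ) ^ 2 + (2 * Real.pi * (n + 1)) ^ 2) / (2 * Real.pi) ^ 2 := by
      rw [hz]; field_simp; rw [← sub_eq_zero]; ring_nf; simp [I_sq]
    have e5 : 1 / (z - (n + 1)) + 1 / (z + (n + 1)) = 2 * z / ((z - (n + 1)) * (z + (n + 1))) := by
      have : z - (n + 1) ≠ 0 := by rwa [sub_eq_add_neg]
      field_simp
      ring
    rw [e5, e4, hz]
    push_cast
    field_simp
  · have e1 : (1 - (Real.exp (-a) : ℂ)) ≠ 0 := by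
      have : Real.exp (-a) < 1 := by rw [Real.exp_lt_one_iff]; linarith
      exact_mod_cast (sub_pos.mpr this).ne'
    rw [hz]
    push_cast at e1 ⊢
    field_simp
    rw [← sub_eq_zero]
    ring_nf
    simp [I_sq]

theorem integral_exp_neg_mul_sin {b : ℝ} (hb : 0 < b) (a : ℝ) :
    ∫ x in Ioi (0 : ℝ), Real.exp (-b * x) * Real.sin (a * x) = a / (a ^ 2 + b ^ 2) := by
  have hre : (-b + a * I : ℂ).re < 0 := by simpa using hb
  have h1 := integral_exp_mul_complex_Ioi hre 0
  have h2 := integrableOn_exp_mul_complex_Ioi hre 0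
  have h3 := congrArg Complex.im h1
  rw [← RCLike.im_eq_complex_im, ← integral_im h2] at h3
  have h4 : ∀ x : ℝ, (RCLike.im (exp ((-b + a * I) * x)) : ℝ) =
      Real.exp (-b * x) * Real.sin (a * x) := by
    intro x
    rw [RCLike.im_eq_complex_im, exp_im]
    simp
  simp only [h4] at h3
  rw [h3]
  have : b ^ 2 + a ^ 2 ≠ 0 := by positivity
  simp [div_im, normSq_apply]
  field_simp
  ring

/-- The sine transform of `1 - coth (π x)`. -/
theorem integral_cothKernel_mul_sin {a : ℝ} (ha : 0 < a) :
    ∫ x in Ioi (0 : ℝ), cothKernel x * Real.sin (a * x) =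
      1 / 2 + 1 / a - (1 - Real.exp (-a))⁻¹ := by
  set b : ℕ → ℝ := fun n => 2 * Real.pi * (n + 1) with hb
  have hb0 : ∀ n, 0 < b n := fun n => by positivity
  have hpt : ∀ x ∈ Ioi (0 : ℝ), ∑' n, -2 * (Real.exp (-b n * x) * Real.sin (a * x)) =
      cothKernel x * Real.sin (a * x) := by
    intro x hx
    have hx : 0 < x := hx
    have hE : Real.exp (-(2 * Real.pi * x)) < 1 := by
      rw [Real.exp_lt_one_iff]
      have : 0 < 2 * Real.pi * x := by positivity
      linarith
    have h1 : ∀ n, Real.exp (-b n * x) =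
        Real.exp (-(2 * Real.pi * x)) * Real.exp (-(2 * Real.pi * x)) ^ n := by
      intro n
      rw [← pow_succ', ← Real.exp_nat_mul]
      congr 1
      rw [hb]; push_cast; ring
    simp only [h1, tsum_mul_left, tsum_mul_right]
    rw [tsum_geometric_of_lt_one (Real.exp_pos _).le hE, cothKernel_eq hx]
    ring
  rw [← setIntegral_congr_fun measurableSet_Ioi hpt]
  -- Bounding `|sin ax|` by `ax` gives norms of order `1/n²`; the bound `1` would only give the
  -- divergent `∑ 1/n`.
  have hdom : ∀ n, IntegrableOn (fun x : ℝ => 2 * a * (x ^ (1 : ℝ) * Real.exp (-b n * x ^ (1 : ℝ))))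
      (Ioi 0) := fun n =>
    (integrableOn_rpow_mul_exp_neg_mul_rpow (by norm_num) one_pos (hb0 n)).const_mul _
  have hle : ∀ n, ∀ x ∈ Ioi (0 : ℝ), ‖-2 * (Real.exp (-b n * x) * Real.sin (a * x))‖ ≤
      2 * a * (x ^ (1 : ℝ) * Real.exp (-b n * x ^ (1 : ℝ))) := by
    intro n x hx
    have hx : 0 < x := hx
    have h1 : |Real.sin (a * x)| ≤ a * x := by
      refine Real.abs_sin_le_abs.trans_eq (abs_of_pos (by positivity))
    rw [Real.rpow_one, norm_mul, norm_mul, Real.norm_eq_abs (Real.exp _), Real.abs_exp,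
      Real.norm_eq_abs (Real.sin _)]
    have h2 : Real.exp (-b n * x) * |Real.sin (a * x)| ≤ Real.exp (-b n * x) * (a * x) := by
      gcongr
    have h3 : ‖(-2 : ℝ)‖ = 2 := by norm_num
    rw [h3]
    linarith
  have hint : ∀ n, IntegrableOn (fun x : ℝ => -2 * (Real.exp (-b n * x) * Real.sin (a * x)))
      (Ioi 0) := fun n => by
    refine (hdom n).mono' (by fun_prop) ?_
    filter_upwards [ae_restrict_mem measurableSet_Ioi] with x hx using hle n x hx
  have hsum := hasSum_integral_of_summable_integral_norm hint ?_
  · refine hsum.unique ?_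
    convert! hasSum_inv_sq_add ha using 2 with n
    rw [integral_const_mul, integral_exp_neg_mul_sin (hb0 n)]
  · refine Summable.of_nonneg_of_le (fun n => by positivity) (fun n =>
      setIntegral_mono_on (hint n).norm (hdom n) measurableSet_Ioi (hle n)) ?_
    have h1 : ∀ n, ∫ x in Ioi (0 : ℝ), 2 * a * (x ^ (1 : ℝ) * Real.exp (-b n * x ^ (1 : ℝ))) =
        2 * a / (2 * Real.pi) ^ 2 * (1 / ((n + 1 : ℕ) : ℝ) ^ 2) := by
      intro n
      have h2 := Real.integral_rpow_mul_exp_neg_mul_Ioi (a := 2) (r := b n) (by norm_num) (hb0 n)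
      norm_num at h2
      simp only [Real.rpow_one, neg_mul]
      rw [integral_const_mul, h2, hb]
      push_cast
      field_simp
    simp only [h1]
    refine Summable.mul_left _ ?_
    exact (summable_nat_add_iff 1).mpr (Real.summable_one_div_nat_pow.mpr one_lt_two)

/-! ### The formula for `k = -a`, `m = -A` with `Re a > 0`, `A > 0`. -/

/-- The density `s ^ (a - 1) e ^ (-s)` of Euler's integral. -/
noncomputable def eulerDensity (a : ℂ) (s : ℝ) : ℂ := (s : ℂ) ^ (a - 1) * exp (-s)

theorem measurable_eulerDensity (a : ℂ) : Measurable (eulerDensity a) := by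
  unfold eulerDensity
  fun_prop

theorem integrableOn_eulerDensity {a : ℂ} (ha : 0 < a.re) :
    IntegrableOn (eulerDensity a) (Ioi 0) := by
  have h := integrableOn_cpow_mul_exp_neg_mul (c := 1) ha (by simp)
  simp only [one_mul] at h
  exact h

theorem integral_eulerDensity {a : ℂ} (ha : 0 < a.re) :
    ∫ s in Ioi (0 : ℝ), eulerDensity a s = Gamma a := by
  simpa [eulerDensity] using integral_cpow_mul_exp_neg_complex_mul (c := 1) ha (by simp)

theorem eulerDensity_mul_exp (a c : ℂ) (s : ℝ) :
    eulerDensity a s * exp (-(c * s)) = (s : ℂ) ^ (a - 1) * exp (-((1 + c) * s)) := by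
  rw [eulerDensity, mul_assoc, ← exp_add]
  ring_nf

theorem integrableOn_eulerDensity_mul_exp {a c : ℂ} (ha : 0 < a.re) (hc : -1 < c.re) :
    IntegrableOn (fun s : ℝ => eulerDensity a s * exp (-(c * s))) (Ioi 0) := by
  simp only [eulerDensity_mul_exp]
  exact integrableOn_cpow_mul_exp_neg_mul ha (by simp; linarith)

theorem integral_eulerDensity_mul_exp {a c : ℂ} (ha : 0 < a.re) (hc : -1 < c.re) :
    ∫ s in Ioi (0 : ℝ), eulerDensity a s * exp (-(c * s)) = (1 + c) ^ (-a) * Gamma a := by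
  simp only [eulerDensity_mul_exp]
  exact integral_cpow_mul_exp_neg_complex_mul ha (by simp; linarith)

/-- The weight `s + A` comes from `|sin((s+A)x)| ≤ (s+A)x`; a factor `s` shifts `a` to `a + 1`. -/
theorem integrableOn_norm_eulerDensity_mul_add {a : ℂ} (ha : 0 < a.re) (A : ℝ) :
    IntegrableOn (fun s : ℝ => ‖eulerDensity a s‖ * (s + A)) (Ioi 0) := by
  have h1 := (integrableOn_eulerDensity (a := a + 1) (by simp; linarith)).norm
  have h2 := (integrableOn_eulerDensity ha).norm.mul_const A
  refine (h1.add h2).congr ?_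
  filter_upwards [ae_restrict_mem measurableSet_Ioi] with s hs
  have hs : 0 < s := hs
  simp only [Pi.add_apply, eulerDensity]
  rw [add_sub_cancel_right, ← ofReal_mul_cpow_sub_one a hs]
  simp only [norm_mul, Complex.norm_of_nonneg hs.le]
  ring

theorem Gamma_mul_rotatedPow {a : ℂ} (ha : 0 < a.re) {σ : ℂ} (hσ : σ.re = 0) (A x : ℝ) :
    Gamma a * rotatedPow σ (-a) (-A) x =
      ∫ s in Ioi (0 : ℝ), eulerDensity a s * exp (-(σ * ((s + A) * x : ℝ))) := by
  have h1 : ∀ s : ℝ, eulerDensity a s * exp (-(σ * ((s + A) * x : ℝ))) =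
      exp (σ * (-A) * x) * (eulerDensity a s * exp (-((σ * x) * s))) := by
    intro s
    rw [mul_left_comm, ← exp_add]
    push_cast
    ring_nf
  simp only [h1]
  rw [integral_const_mul, integral_eulerDensity_mul_exp ha (by simp [hσ]), rotatedPow]
  ring

theorem integrableOn_eulerDensity_mul_rotation {a : ℂ} (ha : 0 < a.re) {σ : ℂ} (hσ : σ.re = 0)
    (A x : ℝ) :
    IntegrableOn (fun s : ℝ => eulerDensity a s * exp (-(σ * ((s + A) * x : ℝ)))) (Ioi 0) := by
  have h1 : ∀ s : ℝ, eulerDensity a s * exp (-(σ * ((s + A) * x : ℝ))) =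
      exp (σ * (-A) * x) * (eulerDensity a s * exp (-((σ * x) * s))) := by
    intro s
    rw [mul_left_comm, ← exp_add]
    push_cast
    ring_nf
  simp only [h1]
  exact (integrableOn_eulerDensity_mul_exp ha (by simp [hσ])).const_mul _

theorem Gamma_mul_polylogIntegrand {a : ℂ} (ha : 0 < a.re) (A x : ℝ) :
    Gamma a * polylogIntegrand (-a) (-A) x = -2 * I *
      ∫ s in Ioi (0 : ℝ), (cothKernel x : ℂ) * (eulerDensity a s * (Real.sin ((s + A) * x) : ℂ)) := by
  have hI : (I : ℂ).re = 0 := by simp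
  have hI' : (-I : ℂ).re = 0 := by simp
  have h := polylogIntegrand_eq (-a) (-A) x
  have e1 := Gamma_mul_rotatedPow ha hI A x
  have e2 := Gamma_mul_rotatedPow ha hI' A x
  rw [h, mul_left_comm, mul_sub, e1, e2, ← integral_sub
    (integrableOn_eulerDensity_mul_rotation ha hI A x)
    (integrableOn_eulerDensity_mul_rotation ha hI' A x), ← integral_const_mul,
    ← integral_const_mul]
  congr 1
  funext s
  rw [ofReal_sin, Complex.sin]
  have : -(-I * (((s + A) * x : ℝ) : ℂ)) = (((s + A) * x : ℝ) : ℂ) * I := by ring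
  rw [this]
  have : -(I * (((s + A) * x : ℝ) : ℂ)) = -(((s + A) * x : ℝ) : ℂ) * I := by ring
  rw [this]
  linear_combination (cothKernel x : ℂ) * eulerDensity a s *
    (exp (-(((s + A) * x : ℝ) : ℂ) * I) - exp ((((s + A) * x : ℝ) : ℂ) * I)) * I_sq

theorem integrableOn_abs_cothKernel_mul :
    IntegrableOn (fun x : ℝ => |cothKernel x| * x) (Ioi 0) := by
  obtain ⟨K, hK, hq⟩ := exists_abs_cothKernel_mul_le (c := 1) (by linarith [Real.pi_gt_three])
  refine (integrableOn_const_mul_exp_neg K one_pos).mono'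
    (measurable_cothKernel.norm.mul measurable_id).aestronglyMeasurable ?_
  filter_upwards [ae_restrict_mem measurableSet_Ioi] with x hx
  have hx : 0 < x := hx
  rw [Real.norm_of_nonneg (by positivity)]
  exact hq x hx

theorem ae_restrict_Ioi_prod :
    ∀ᵐ p ∂((volume.restrict (Ioi (0 : ℝ))).prod (volume.restrict (Ioi (0 : ℝ)))),
      0 < p.1 ∧ 0 < p.2 := by
  rw [Measure.prod_restrict]
  filter_upwards [ae_restrict_mem (measurableSet_Ioi.prod measurableSet_Ioi)] with p hp using hp

/-- Fubini and the sine transform at `s + A`. The bound on the sine gives a dominating function that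
is a product of one in `x` and one in `s`. -/
theorem Gamma_mul_integral_polylogIntegrand {a : ℂ} (ha : 0 < a.re) {A : ℝ} (hA : 0 < A) :
    Gamma a * ∫ x in Ioi (0 : ℝ), polylogIntegrand (-a) (-A) x = -2 * I *
      ∫ s in Ioi (0 : ℝ), eulerDensity a s *
        ((1 / 2 + 1 / (s + A) - (1 - Real.exp (-(s + A)))⁻¹ : ℝ) : ℂ) := by
  rw [← integral_const_mul]
  simp only [Gamma_mul_polylogIntegrand ha]
  rw [integral_const_mul, integral_integral_swap]
  · congr 1
    refine setIntegral_congr_fun measurableSet_Ioi fun s hs => ?_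
    have hs : 0 < s := hs
    rw [← integral_cothKernel_mul_sin (add_pos hs hA), ← integral_complex_ofReal, ← integral_const_mul]
    congr 1
    funext x
    push_cast
    ring
  · have hdom := integrableOn_abs_cothKernel_mul.mul_prod
      (integrableOn_norm_eulerDensity_mul_add ha A)
    refine Integrable.mono' hdom ?_ ?_
    · refine Measurable.aestronglyMeasurable ?_
      have h1 := measurable_cothKernel
      have h2 := measurable_eulerDensity a
      simp only [Function.uncurry_def]
      fun_prop
    · filter_upwards [ae_restrict_Ioi_prod] with p hp
      obtain ⟨h1, h2⟩ := hp
      simp only [Function.uncurry, norm_mul, norm_real, Real.norm_eq_abs]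
      have h3 : |Real.sin ((p.2 + A) * p.1)| ≤ (p.2 + A) * p.1 :=
        Real.abs_sin_le_abs.trans_eq (abs_of_pos (by positivity))
      calc |cothKernel p.1| * (‖eulerDensity a p.2‖ * |Real.sin ((p.2 + A) * p.1)|)
          ≤ |cothKernel p.1| * (‖eulerDensity a p.2‖ * ((p.2 + A) * p.1)) := by gcongr
        _ = _ := by ring

/-- Write `1/(s+A)` as `∫ e^(-(s+A)u) du` and integrate over `s` first. -/
theorem integral_eulerDensity_div {a : ℂ} (ha : 0 < a.re) {A : ℝ} (hA : 0 < A) :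
    ∫ s in Ioi (0 : ℝ), eulerDensity a s * ((1 / (s + A) : ℝ) : ℂ) =
      Gamma a * ∫ u in Ioi (0 : ℝ), exp (-(A * u)) * (1 + u) ^ (-a) := by
  have h1 : ∀ s ∈ Ioi (0 : ℝ), eulerDensity a s * ((1 / (s + A) : ℝ) : ℂ) =
      ∫ u in Ioi (0 : ℝ), eulerDensity a s * exp (-(u * s)) * exp (-(A * u)) := by
    intro s hs
    have hs : 0 < s := hs
    have h2 : ∀ u : ℝ, eulerDensity a s * exp (-(u * s)) * exp (-(A * u)) =
        eulerDensity a s * exp (-((s : ℂ) + A) * u) := by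
      intro u
      rw [mul_assoc, ← exp_add]
      ring_nf
    simp only [h2]
    rw [integral_const_mul, integral_exp_mul_complex_Ioi (by simp; linarith)]
    rw [ofReal_zero, mul_zero, exp_zero, neg_div_neg_eq]
    push_cast
    rfl
  rw [setIntegral_congr_fun measurableSet_Ioi h1, ← integral_const_mul, integral_integral_swap]
  · refine setIntegral_congr_fun measurableSet_Ioi fun u hu => ?_
    have hu : 0 < u := hu
    rw [integral_mul_const, integral_eulerDensity_mul_exp ha (by simp; linarith)]
    ring
  · have hdom := (integrableOn_eulerDensity ha).norm.mul_prod
      (integrableOn_const_mul_exp_neg 1 hA)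
    refine Integrable.mono' hdom ?_ ?_
    · refine Measurable.aestronglyMeasurable ?_
      have h2 := measurable_eulerDensity a
      simp only [Function.uncurry_def]
      fun_prop
    · filter_upwards [ae_restrict_Ioi_prod] with p hp
      obtain ⟨h1, h2⟩ := hp
      simp only [Function.uncurry, norm_mul, norm_exp]
      have h3 : (-((p.2 : ℂ) * p.1)).re ≤ 0 := by
        simp; positivity
      have h4 : (-((A : ℂ) * p.2)).re = -A * p.2 := by simp
      rw [h4, one_mul]
      have := Real.exp_le_one_iff.mpr h3
      calc ‖eulerDensity a p.1‖ * Real.exp (-((p.2 : ℂ) * p.1)).re * Real.exp (-A * p.2)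
          ≤ ‖eulerDensity a p.1‖ * 1 * Real.exp (-A * p.2) := by gcongr
        _ = _ := by ring

theorem hasSum_integral_eulerDensity_geometric {a : ℂ} (ha : 0 < a.re) {A : ℝ} (hA : 0 < A) :
    HasSum (fun n : ℕ => exp (-(A * n)) * ((1 + n : ℂ) ^ (-a) * Gamma a))
      (∫ s in Ioi (0 : ℝ), eulerDensity a s * (((1 - Real.exp (-(s + A)))⁻¹ : ℝ) : ℂ)) := by
  have hint : ∀ n : ℕ, IntegrableOn
      (fun s : ℝ => exp (-(A * n)) * (eulerDensity a s * exp (-(n * s)))) (Ioi 0) := fun n =>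
    (integrableOn_eulerDensity_mul_exp ha (by
      rw [natCast_re]; linarith [(Nat.cast_nonneg n : (0 : ℝ) ≤ n)])).const_mul _
  have hsum := hasSum_integral_of_summable_integral_norm hint ?_
  · convert! hsum using 1
    · funext n
      rw [integral_const_mul, integral_eulerDensity_mul_exp ha]
      rw [natCast_re]; linarith [(Nat.cast_nonneg n : (0 : ℝ) ≤ n)]
    · refine setIntegral_congr_fun measurableSet_Ioi fun s hs => ?_
      have hs : 0 < s := hs
      have h1 : ∀ n : ℕ, exp (-(A * n)) * (eulerDensity a s * exp (-(n * s))) =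
          eulerDensity a s * (Real.exp (-(s + A)) : ℂ) ^ n := by
        intro n
        rw [mul_left_comm, ← exp_add, ofReal_exp, ← exp_nat_mul]
        push_cast
        ring_nf
      simp only [h1]
      rw [tsum_mul_left, tsum_geometric_of_norm_lt_one]
      · push_cast; rfl
      · rw [norm_real, Real.norm_eq_abs, Real.abs_exp, Real.exp_lt_one_iff]
        linarith
  · have hg : Summable fun n : ℕ =>
        Real.exp (-A) ^ n * ∫ s in Ioi (0 : ℝ), ‖eulerDensity a s‖ :=
      (summable_geometric_of_lt_one (Real.exp_pos _).le
        (by rw [Real.exp_lt_one_iff]; linarith)).mul_right _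
    refine Summable.of_nonneg_of_le (fun n => by positivity) (fun n => ?_) hg
    rw [← integral_const_mul]
    refine setIntegral_mono_on (hint n).norm
      ((integrableOn_eulerDensity ha).norm.const_mul _) measurableSet_Ioi fun s hs => ?_
    have hs : 0 < s := hs
    rw [norm_mul, norm_mul, norm_exp, norm_exp]
    have h3 : (-((n : ℂ) * s)).re ≤ 0 := by
      simp; positivity
    have h4 : Real.exp (-((A : ℂ) * n)).re = Real.exp (-A) ^ n := by
      rw [← Real.exp_nat_mul]; congr 1; simp; ring
    rw [h4]
    have := Real.exp_le_one_iff.mpr h3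
    calc Real.exp (-A) ^ n * (‖eulerDensity a s‖ * Real.exp (-((n : ℂ) * s)).re)
        ≤ Real.exp (-A) ^ n * (‖eulerDensity a s‖ * 1) := by gcongr
      _ = _ := by ring

/-- `A ^ (-k - 1) Γ(k + 1, A) = e ^ (-A) ∫ e ^ (-A u) (1 + u) ^ k du` for `A > 0`. -/
theorem cpow_mul_upperIncompleteGamma_ofReal (k : ℂ) {A : ℝ} (hA : 0 < A) :
    (A : ℂ) ^ (-k - 1) * upperIncompleteGamma (k + 1) A =
      exp (-A) * ∫ u in Ioi (0 : ℝ), exp (-(A * u)) * (1 + u) ^ k := by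
  have hA' : (A : ℂ) ≠ 0 := by exact_mod_cast hA.ne'
  rw [upperIncompleteGamma_eq_of_mem_slitPlane _ (ofReal_mem_slitPlane.mpr hA)]
  have h1 := integral_comp_mul_left_Ioi
    (fun v : ℝ => gammaIntegrand (k + 1) (A + v)) 0 hA
  rw [mul_zero] at h1
  have h2 : ∀ u ∈ Ioi (0 : ℝ), gammaIntegrand (k + 1) (A + (A * u : ℝ)) =
      (A : ℂ) ^ k * exp (-A) * (exp (-(A * u)) * (1 + u) ^ k) := by
    intro u hu
    have hu : 0 < u := hu
    have e1 : (A : ℂ) + (A * u : ℝ) = (A : ℂ) * ((1 + u : ℝ) : ℂ) := by push_cast; ring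
    rw [gammaIntegrand, add_sub_cancel_right, e1, mul_cpow_ofReal_nonneg hA.le (by linarith)]
    have e2 : exp (-((A : ℂ) * ((1 + u : ℝ) : ℂ))) = exp (-A) * exp (-(A * u)) := by
      rw [← exp_add]; push_cast; ring_nf
    rw [e2]
    push_cast
    ring
  rw [setIntegral_congr_fun measurableSet_Ioi h2, integral_const_mul] at h1
  have h3 : ∫ v in Ioi (0 : ℝ), gammaIntegrand (k + 1) (A + v) =
      (A : ℂ) * ((A : ℂ) ^ k * exp (-A) *
        ∫ u in Ioi (0 : ℝ), exp (-(A * u)) * (1 + u) ^ k) := by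
    rw [h1, real_smul]
    push_cast
    rw [mul_inv_cancel_left₀ hA']
  have h4 : (A : ℂ) ^ (-k - 1) * ((A : ℂ) * (A : ℂ) ^ k) = 1 := by
    rw [cpow_sub _ _ hA', cpow_neg, cpow_one]
    have : (A : ℂ) ^ k ≠ 0 := by simp [cpow_eq_zero_iff, hA']
    field_simp
  rw [h3]
  linear_combination (exp (-A) * ∫ u in Ioi (0 : ℝ), exp (-(A * u)) * (1 + u : ℂ) ^ k) * h4

/-- The right-hand side of the integral formula for the polylogarithm. -/
noncomputable def polylogFormula (k m : ℂ) : ℂ :=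
  exp m / 2 + (-m) ^ (-k - 1) * upperIncompleteGamma (k + 1) (-m) -
    I * exp m / 2 * ∫ x in Ioi (0 : ℝ), polylogIntegrand k m x

/-- Since `(-i e^m/2)(-2i) = -e^m`, the first two terms of the transform cancel `e^m/2` and the
gamma term. Only the geometric series is left. -/
theorem hasSum_polylogFormula_neg {a : ℂ} (ha : 0 < a.re) {A : ℝ} (hA : 0 < A) :
    HasSum (fun n : ℕ => exp (-A) ^ (n + 1) / ((n + 1 : ℕ) : ℂ) ^ a) (polylogFormula (-a) (-A)) := by
  have hΓ : Gamma a ≠ 0 := Gamma_ne_zero_of_re_pos ha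
  have h1 := Gamma_mul_integral_polylogIntegrand ha hA
  have h2 := integral_eulerDensity_div ha hA
  have h3 := hasSum_integral_eulerDensity_geometric ha hA
  have h4 := cpow_mul_upperIncompleteGamma_ofReal (-a) hA
  have hi1 : IntegrableOn (fun s : ℝ => eulerDensity a s * ((1 / 2 : ℝ) : ℂ)) (Ioi 0) :=
    (integrableOn_eulerDensity ha).mul_const _
  have hbdd : ∀ g : ℝ → ℝ, Measurable g → ∀ C : ℝ, (∀ s ∈ Ioi (0 : ℝ), |g s| ≤ C) →
      IntegrableOn (fun s : ℝ => eulerDensity a s * (g s : ℂ)) (Ioi 0) := by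
    intro g hg C hC
    refine ((integrableOn_eulerDensity ha).norm.mul_const C).mono' ?_ ?_
    · exact ((measurable_eulerDensity a).mul
        (measurable_ofReal.comp hg)).aestronglyMeasurable
    · filter_upwards [ae_restrict_mem measurableSet_Ioi] with s hs
      rw [norm_mul, norm_real, Real.norm_eq_abs]
      gcongr
      exact hC s hs
  have hi2 : IntegrableOn (fun s : ℝ => eulerDensity a s * ((1 / (s + A) : ℝ) : ℂ)) (Ioi 0) := by
    refine hbdd _ (by fun_prop) (1 / A) fun s hs => ?_
    have hs : 0 < s := hs
    rw [abs_of_pos (by positivity)]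
    gcongr
    linarith
  have hi3 : IntegrableOn (fun s : ℝ => eulerDensity a s *
      (((1 - Real.exp (-(s + A)))⁻¹ : ℝ) : ℂ)) (Ioi 0) := by
    refine hbdd _ (by fun_prop) (1 - Real.exp (-A))⁻¹ fun s hs => ?_
    have hs : 0 < s := hs
    have e1 : Real.exp (-A) < 1 := by rw [Real.exp_lt_one_iff]; linarith
    have e2 : Real.exp (-(s + A)) ≤ Real.exp (-A) := Real.exp_le_exp.mpr (by linarith)
    rw [abs_of_pos (inv_pos.mpr (by linarith))]
    exact inv_anti₀ (by linarith) (by linarith)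
  have h5 : ∫ s in Ioi (0 : ℝ), eulerDensity a s *
        ((1 / 2 + 1 / (s + A) - (1 - Real.exp (-(s + A)))⁻¹ : ℝ) : ℂ) =
      Gamma a / 2 + Gamma a * (∫ u in Ioi (0 : ℝ), exp (-(A * u)) * (1 + u) ^ (-a)) -
        ∫ s in Ioi (0 : ℝ), eulerDensity a s * (((1 - Real.exp (-(s + A)))⁻¹ : ℝ) : ℂ) := by
    simp only [ofReal_sub, ofReal_add _ (1 / (_ : ℝ)), mul_sub, mul_add]
    rw [integral_sub (hi1.fun_add hi2) hi3, integral_add hi1 hi2, h2, integral_mul_const,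
      integral_eulerDensity ha]
    push_cast
    ring
  have h6 := h3.mul_left (exp (-A) / Gamma a)
  convert! h6 using 1
  · funext n
    have e1 : exp (-(A : ℂ)) ^ (n + 1) = exp (-A) * exp (-(A * n)) := by
      rw [← exp_nat_mul, ← exp_add]; push_cast; ring_nf
    rw [e1, cpow_neg]
    push_cast
    rw [add_comm (1 : ℂ)]
    field_simp
  · rw [polylogFormula, neg_neg (A : ℂ), h4]
    rw [h5] at h1
    have h7 : ∫ x in Ioi (0 : ℝ), polylogIntegrand (-a) (-A) x = -2 * I *
        (Gamma a / 2 + Gamma a * (∫ u in Ioi (0 : ℝ), exp (-(A * u)) * (1 + u) ^ (-a)) -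
        ∫ s in Ioi (0 : ℝ), eulerDensity a s * (((1 - Real.exp (-(s + A)))⁻¹ : ℝ) : ℂ)) /
          Gamma a := by
      rw [← h1]; field_simp
    rw [h7]
    generalize ∫ s in Ioi (0 : ℝ), eulerDensity a s * (((1 - Real.exp (-(s + A)))⁻¹ : ℝ) : ℂ) = S
    field_simp
    ring_nf
    simp only [I_sq]
    ring

/-! ### The formula as a holomorphic function of `m`. -/

/-- The strip `|Im m| < 2π` without `[0, ∞)`. -/
def slitStrip : Set ℂ := {m : ℂ | |m.im| < 2 * Real.pi ∧ -m ∈ slitPlane}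

theorem isOpen_slitStrip : IsOpen slitStrip :=
  (isOpen_lt (continuous_abs.comp continuous_im) continuous_const).inter
    (isOpen_slitPlane.preimage continuous_neg)

theorem isPreconnected_slitStrip : IsPreconnected slitStrip := by
  have h1 : StarConvex ℝ (-1) (-slitPlane) := starConvex_one_slitPlane.neg
  have h2 : StarConvex ℝ (-1 : ℂ) {m : ℂ | |m.im| < 2 * Real.pi} := by
    have : {m : ℂ | |m.im| < 2 * Real.pi} = imLm ⁻¹' Ioo (-(2 * Real.pi)) (2 * Real.pi) := by
      ext m; simp [abs_lt]
    rw [this]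
    exact ((convex_Ioo _ _).linear_preimage imLm).starConvex (by simp [Real.pi_pos])
  have h3 : slitStrip = {m : ℂ | |m.im| < 2 * Real.pi} ∩ -slitPlane := rfl
  rw [h3]
  exact ((h2.inter h1).isPathConnected ⟨by simp [Real.pi_pos], by simp⟩).isConnected.isPreconnected

/-- The two terms of the product rule are those of the recurrence for `Γ(k + 2, -m)`, times
`(-m)^(-k-2)`. -/
theorem hasDerivAt_cpow_mul_upperIncompleteGamma (k : ℂ) {m : ℂ} (hm : -m ∈ slitPlane) :
    HasDerivAt (fun m => (-m) ^ (-k - 1) * upperIncompleteGamma (k + 1) (-m))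
      ((-m) ^ (-(k + 1) - 1) * upperIncompleteGamma (k + 1 + 1) (-m)) m := by
  have h0 : -m ≠ 0 := slitPlane_ne_zero hm
  have h1 := (hasDerivAt_neg' m).cpow_const (c := -k - 1) hm
  have h2 := (hasDerivAt_upperIncompleteGamma (k + 1) hm).comp m (hasDerivAt_neg' m)
  refine (h1.fun_mul h2).congr_deriv ?_
  rw [upperIncompleteGamma_recurrence (k + 1 + 1) hm]
  simp only [gammaIntegrand, add_sub_cancel_right, Function.comp_apply]
  have e1 : (-m) ^ (-k - 1) = (-m) ^ (-(k + 1) - 1) * (-m) := by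
    nth_rewrite 3 [← cpow_one (-m)]
    rw [← cpow_add _ _ h0]
    ring_nf
  have e2 : (-m) ^ (k + 1) = (-m) ^ k * (-m) := by
    rw [cpow_add _ _ h0, cpow_one]
  have e3 : -k - 1 - 1 = -(k + 1) - 1 := by ring
  rw [e1, e2, e3]
  ring

theorem hasDerivAt_polylogFormula (k : ℂ) {m : ℂ} (hm : m ∈ slitStrip) :
    HasDerivAt (polylogFormula k) (polylogFormula (k + 1) m) m := by
  have h1 := (hasDerivAt_exp m).div_const 2
  have h2 := hasDerivAt_cpow_mul_upperIncompleteGamma k hm.2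
  have h3 := (((hasDerivAt_exp m).const_mul I).div_const 2).fun_mul
    (hasDerivAt_integral_polylogIntegrand k hm.1)
  refine ((h1.fun_add h2).fun_sub h3).congr_deriv ?_
  rw [polylogFormula]
  ring

theorem differentiableOn_polylogFormula (k : ℂ) :
    DifferentiableOn ℂ (polylogFormula k) slitStrip := fun _ hm =>
  (hasDerivAt_polylogFormula k hm).differentiableAt.differentiableWithinAt

/-! ### The series in the unit disc. -/

/-- The sum of the polylogarithm series. -/
noncomputable def polylogSeries (s z : ℂ) : ℂ := ∑' n : ℕ, z ^ (n + 1) / ((n + 1 : ℕ) : ℂ) ^ s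

theorem exists_summable_bound_polylogSeries (s : ℂ) {r : ℝ} (hr : r < 1) :
    ∃ u : ℕ → ℝ, Summable u ∧ ∀ (n : ℕ) (z : ℂ), ‖z‖ < r →
      ‖z ^ (n + 1) / ((n + 1 : ℕ) : ℂ) ^ s‖ ≤ u n := by
  rcases le_or_gt r 0 with h0 | h0
  · exact ⟨0, summable_zero, fun n z hz => absurd (hz.trans_le h0) (norm_nonneg z).not_gt⟩
  have hlog : Real.log r < 0 := Real.log_neg h0 hr
  -- This `ε` makes the ratio of the majorant `r · r^(-1/2) = √r < 1`.
  obtain ⟨C, hC, h⟩ := norm_cpow_le_exp (-s) one_pos (ε := -Real.log r / 2) (by linarith)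
  have hρ : r * Real.exp (-Real.log r / 2) < 1 := by
    nth_rewrite 1 [← Real.exp_log h0]
    rw [← Real.exp_add, Real.exp_lt_one_iff]
    linarith
  refine ⟨fun n => C * (r * Real.exp (-Real.log r / 2)) ^ (n + 1), ?_, fun n z hz => ?_⟩
  · exact ((summable_nat_add_iff 1).mpr
      (summable_geometric_of_lt_one (by positivity) hρ)).mul_left C
  · have h1 : (1 : ℝ) ≤ ‖((n + 1 : ℕ) : ℂ)‖ := by
      rw [norm_natCast]; exact_mod_cast Nat.le_add_left 1 n
    have h2 := h _ h1
    rw [norm_natCast] at h2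
    rw [div_eq_mul_inv, ← cpow_neg, norm_mul, norm_pow]
    calc ‖z‖ ^ (n + 1) * ‖((n + 1 : ℕ) : ℂ) ^ (-s)‖
        ≤ r ^ (n + 1) * (C * Real.exp (-Real.log r / 2 * (n + 1 : ℕ))) := by gcongr
      _ = C * (r * Real.exp (-Real.log r / 2)) ^ (n + 1) := by
          rw [mul_pow, ← Real.exp_nat_mul]; ring_nf

theorem hasSum_polylogSeries (s : ℂ) {z : ℂ} (hz : ‖z‖ < 1) :
    HasSum (fun n : ℕ => z ^ (n + 1) / ((n + 1 : ℕ) : ℂ) ^ s) (polylogSeries s z) := by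
  obtain ⟨r, hr, hr1⟩ := exists_between hz
  obtain ⟨u, hu, hb⟩ := exists_summable_bound_polylogSeries s hr1
  exact (Summable.of_norm_bounded hu fun n => hb n z hr).hasSum

/-- Termwise differentiation. The form `z * d` avoids a division at `z = 0`. -/
theorem hasDerivAt_polylogSeries (s : ℂ) {z : ℂ} (hz : ‖z‖ < 1) :
    ∃ d : ℂ, HasDerivAt (polylogSeries s) d z ∧ z * d = polylogSeries (s - 1) z := by
  obtain ⟨r, hr, hr1⟩ := exists_between hz
  obtain ⟨u, hu, hb⟩ := exists_summable_bound_polylogSeries s hr1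
  have hopen : IsOpen {z : ℂ | ‖z‖ < r} := isOpen_lt continuous_norm continuous_const
  have hd : ∀ (n : ℕ) (w : ℂ), HasDerivAt (fun z : ℂ => z ^ (n + 1) / ((n + 1 : ℕ) : ℂ) ^ s)
      (((n + 1 : ℕ) * w ^ n) / ((n + 1 : ℕ) : ℂ) ^ s) w := fun n w => by
    simpa using (hasDerivAt_pow (n + 1) w).div_const (((n + 1 : ℕ) : ℂ) ^ s)
  have hdiff : ∀ n : ℕ, DifferentiableOn ℂ
      (fun z : ℂ => z ^ (n + 1) / ((n + 1 : ℕ) : ℂ) ^ s) {z : ℂ | ‖z‖ < r} :=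
    fun n w _ => (hd n w).differentiableAt.differentiableWithinAt
  have h1 := differentiableOn_tsum_of_summable_norm hu hdiff hopen (fun n w hw => hb n w hw)
  have h2 := hasSum_deriv_of_summable_norm hu hdiff hopen (fun n w hw => hb n w hw) hr
  refine ⟨_, (h1.differentiableAt (hopen.mem_nhds hr)).hasDerivAt, ?_⟩
  refine (h2.mul_left z).unique ?_
  convert! hasSum_polylogSeries (s - 1) hz using 1
  funext n
  have hn : ((n + 1 : ℕ) : ℂ) ≠ 0 := by exact_mod_cast n.succ_ne_zero
  have hns : ((n + 1 : ℕ) : ℂ) ^ s ≠ 0 := by simp [cpow_eq_zero_iff, hn, -Nat.cast_add]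
  rw [(hd n z).deriv, cpow_sub _ _ hn, cpow_one]
  field_simp
  ring

theorem hasDerivAt_polylogSeries_exp (s : ℂ) {m : ℂ} (hm : m.re < 0) :
    HasDerivAt (fun m => polylogSeries s (exp m)) (polylogSeries (s - 1) (exp m)) m := by
  have h1 : ‖exp m‖ < 1 := by rwa [norm_exp, Real.exp_lt_one_iff]
  obtain ⟨d, hd, hd'⟩ := hasDerivAt_polylogSeries s h1
  refine (hd.comp m (hasDerivAt_exp m)).congr_deriv ?_
  rw [← hd']
  ring

/-! ### Formula and series agree for `Re m < 0`; periodicity. -/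

theorem ofReal_mem_slitStrip {t : ℝ} (ht : t < 0) : (t : ℂ) ∈ slitStrip :=
  ⟨by simp [Real.pi_pos], Or.inl (by simpa using ht)⟩

theorem polylogFormula_ofReal_eq (k : ℂ) {t : ℝ} (ht : t < 0) :
    polylogFormula k t = polylogSeries (-k) (exp t) := by
  -- Induction on a bound `Re k < N`. For `N = 0` Euler's integral applies; the step differentiates
  -- the identity for `k - 1` along the real axis.
  obtain ⟨N, hN⟩ := exists_nat_gt k.re
  induction N generalizing k t with
  | zero =>
    have h := hasSum_polylogFormula_neg (a := -k) (by simpa using hN) (A := -t) (by linarith)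
    have h1 : ‖exp (t : ℂ)‖ < 1 := by rw [norm_exp]; simpa using ht
    simp only [ofReal_neg, neg_neg] at h
    exact h.unique (hasSum_polylogSeries (-k) h1)
  | succ N ih =>
    have h1 := (hasDerivAt_polylogFormula (k - 1) (ofReal_mem_slitStrip ht)).comp_ofReal
    have h2 := (hasDerivAt_polylogSeries_exp (-(k - 1)) (m := (t : ℂ)) (by simpa using ht)).comp_ofReal
    rw [sub_add_cancel] at h1
    have e : -(k - 1) - 1 = -k := by ring
    rw [e] at h2
    refine h1.unique (h2.congr_of_eventuallyEq ?_)
    filter_upwards [gt_mem_nhds ht] with x hx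
    refine ih (k - 1) hx ?_
    push_cast at hN
    simp
    linarith

theorem polylogFormula_eq_polylogSeries (k : ℂ) {m : ℂ} (him : |m.im| < 2 * Real.pi)
    (hre : m.re < 0) : polylogFormula k m = polylogSeries (-k) (exp m) := by
  set U : Set ℂ := {m : ℂ | |m.im| < 2 * Real.pi ∧ m.re < 0} with hU
  have hopen : IsOpen U := (isOpen_lt (continuous_abs.comp continuous_im) continuous_const).inter
    (isOpen_lt continuous_re continuous_const)
  have hconv : Convex ℝ U := by
    have : U = imLm ⁻¹' Ioo (-(2 * Real.pi)) (2 * Real.pi) ∩ reLm ⁻¹' Iio 0 := by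
      ext m; simp [hU, abs_lt]
    rw [this]
    exact ((convex_Ioo _ _).linear_preimage imLm).inter ((convex_Iio _).linear_preimage reLm)
  refine eqOn_of_eventuallyEq_ofReal hopen hconv.isPreconnected (x₀ := -1)
    (f := polylogFormula k) (g := fun m => polylogSeries (-k) (exp m)) ?_ ?_ ?_ ?_ ⟨him, hre⟩
  · exact (differentiableOn_polylogFormula k).mono fun m hm => ⟨hm.1, Or.inl (by simpa using hm.2)⟩
  · exact fun m hm =>
      (hasDerivAt_polylogSeries_exp (-k) hm.2).differentiableAt.differentiableWithinAt
  · simp [hU, Real.pi_pos]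
  · filter_upwards [gt_mem_nhds (show (-1 : ℝ) < 0 by norm_num)] with t ht
    exact polylogFormula_ofReal_eq k ht

/-- Both sides are analytic in the open strip `-2π < Im m < 0`, where neither `m` nor `m + 2πi`
meets the slit, and for `Re m < 0` both equal the series at `e^m`. -/
theorem polylogFormula_add_two_pi_I (k : ℂ) {m : ℂ} (h1 : -(2 * Real.pi) < m.im) (h2 : m.im < 0) :
    polylogFormula k (m + 2 * Real.pi * I) = polylogFormula k m := by
  set V : Set ℂ := imLm ⁻¹' Ioo (-(2 * Real.pi)) 0 with hV
  have hpi := Real.pi_pos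
  have hopen : IsOpen V := isOpen_Ioo.preimage continuous_im
  have hconv : Convex ℝ V := (convex_Ioo _ _).linear_preimage imLm
  have him : ∀ m : ℂ, (m + 2 * Real.pi * I).im = m.im + 2 * Real.pi := fun m => by simp
  have hre : ∀ m : ℂ, (m + 2 * Real.pi * I).re = m.re := fun m => by simp
  have hs : ∀ m ∈ V, m ∈ slitStrip := fun m hm => by
    have hm : -(2 * Real.pi) < m.im ∧ m.im < 0 := hm
    refine ⟨abs_lt.mpr ⟨hm.1, by linarith⟩, Or.inr ?_⟩
    rw [neg_im]
    linarith
  have hs' : ∀ m ∈ V, m + 2 * Real.pi * I ∈ slitStrip := fun m hm => by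
    have hm : -(2 * Real.pi) < m.im ∧ m.im < 0 := hm
    refine ⟨?_, Or.inr ?_⟩
    · rw [him]; exact abs_lt.mpr ⟨by linarith, by linarith⟩
    · rw [neg_im, him]; linarith
  have hf : DifferentiableOn ℂ (fun m => polylogFormula k (m + 2 * Real.pi * I)) V := fun m hm =>
    ((hasDerivAt_polylogFormula k (hs' m hm)).comp_add_const m
      (2 * Real.pi * I)).differentiableAt.differentiableWithinAt
  have hg : DifferentiableOn ℂ (polylogFormula k) V := (differentiableOn_polylogFormula k).mono hs
  have hz : (-1 - Real.pi * I : ℂ) ∈ V := by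
    change _ < (-1 - Real.pi * I : ℂ).im ∧ (-1 - Real.pi * I : ℂ).im < _
    simp [hpi]
  refine (hf.analyticOnNhd hopen).eqOn_of_preconnected_of_eventuallyEq (hg.analyticOnNhd hopen)
    hconv.isPreconnected hz ?_ (show m ∈ V from ⟨h1, h2⟩)
  have hnear : ∀ᶠ m : ℂ in 𝓝 (-1 - Real.pi * I), m.re < 0 :=
    (isOpen_lt continuous_re continuous_const).mem_nhds (by simp)
  filter_upwards [hnear, hopen.mem_nhds hz] with m hm hmV
  rw [polylogFormula_eq_polylogSeries k (hs m hmV).1 hm,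
    polylogFormula_eq_polylogSeries k (hs' m hmV).1 (by rwa [hre]), exp_add, exp_two_pi_mul_I,
    mul_one]

theorem polylogFormula_eq_of_exp_eq (k : ℂ) {m m' : ℂ} (hm : |m.im| < 2 * Real.pi)
    (hm' : |m'.im| < 2 * Real.pi) (h : exp m = exp m') :
    polylogFormula k m = polylogFormula k m' := by
  obtain ⟨n, hn⟩ := exp_eq_exp_iff_exists_int.mp h
  have hpi := Real.pi_pos
  rw [abs_lt] at hm hm'
  have him : m.im = m'.im + n * (2 * Real.pi) := by rw [hn]; simp
  have h1 : (n : ℝ) < 2 := by nlinarith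
  have h2 : (-2 : ℝ) < n := by nlinarith
  have h1' : n < 2 := by exact_mod_cast h1
  have h2' : -2 < n := by exact_mod_cast h2
  obtain rfl | rfl | rfl : n = -1 ∨ n = 0 ∨ n = 1 := by omega
  · have e : m' = m + 2 * Real.pi * I := by rw [hn]; push_cast; ring
    push_cast at him
    rw [e, polylogFormula_add_two_pi_I k (by linarith) (by linarith)]
  · simp [hn]
  · have e : m = m' + 2 * Real.pi * I := by rw [hn]; push_cast; ring
    push_cast at him
    rw [e, polylogFormula_add_two_pi_I k (by linarith) (by linarith)]

/-! ### Descent to `z = e^m` and the polylogarithm off the cut. -/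

theorem mem_slitStrip_of_one_sub_exp_mem {m : ℂ} (him : |m.im| < 2 * Real.pi)
    (h : 1 - exp m ∈ slitPlane) : m ∈ slitStrip := by
  refine ⟨him, ?_⟩
  by_contra hcon
  rw [mem_slitPlane_iff, not_or, neg_re, neg_im, not_lt, not_not] at hcon
  obtain ⟨t, ht⟩ : ∃ t : ℝ, m = t := ⟨m.re, ext rfl (by simpa using hcon.2)⟩
  have ht0 : 0 ≤ t := by simpa [ht] using hcon.1
  rw [ht, ← ofReal_exp, ← ofReal_one, ← ofReal_sub, ofReal_mem_slitPlane] at h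
  linarith [Real.one_le_exp ht0]

theorem one_sub_exp_mem_slitPlane {m : ℂ} (hm : m ∈ slitStrip) : 1 - exp m ∈ slitPlane := by
  by_contra hcon
  rw [mem_slitPlane_iff, not_or, sub_re, sub_im, one_re, one_im, not_lt, not_not] at hcon
  obtain ⟨x, hx⟩ : ∃ x : ℝ, exp m = x := ⟨(exp m).re, ext rfl (by simpa using hcon.2)⟩
  have hx1 : 1 ≤ x := by simpa [hx] using hcon.1
  have hxe : exp m = exp (Real.log x : ℝ) := by
    rw [hx, ← ofReal_exp, Real.exp_log (by linarith)]
  obtain ⟨n, hn⟩ := exp_eq_exp_iff_exists_int.mp hxe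
  have hpi := Real.pi_pos
  have him : m.im = n * (2 * Real.pi) := by rw [hn]; simp
  have h1 := hm.1
  rw [him, abs_lt] at h1
  have h2 : (n : ℝ) < 1 := by nlinarith
  have h3 : (-1 : ℝ) < n := by nlinarith
  have h2' : n < 1 := by exact_mod_cast h2
  have h3' : -1 < n := by exact_mod_cast h3
  obtain rfl : n = 0 := by omega
  have h4 := hm.2
  have h5 : m = (Real.log x : ℝ) := by simpa using hn
  rw [h5, ← ofReal_neg, ofReal_mem_slitPlane] at h4
  linarith [Real.log_nonneg hx1]

/-- An analytic continuation of the polylogarithm series. -/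
noncomputable def polylogContinuation (k z : ℂ) : ℂ :=
  if ‖z‖ < 1 then polylogSeries (-k) z else polylogFormula k (log z)

theorem abs_log_im_lt_two_pi (z : ℂ) : |(log z).im| < 2 * Real.pi := by
  rw [log_im]
  linarith [abs_arg_le_pi z, Real.pi_pos]

theorem polylogContinuation_exp (k : ℂ) {m : ℂ} (him : |m.im| < 2 * Real.pi) :
    polylogContinuation k (exp m) = polylogFormula k m := by
  rw [polylogContinuation]
  split_ifs with h
  · rw [norm_exp, Real.exp_lt_one_iff] at h
    exact (polylogFormula_eq_polylogSeries k him h).symm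
  · exact polylogFormula_eq_of_exp_eq k (abs_log_im_lt_two_pi _) him (exp_log (exp_ne_zero m))

/-- By `polylogContinuation_exp` any local logarithm with values in the strip computes the
continuation, so one may be chosen that is holomorphic at `z`. -/
theorem differentiableAt_polylogContinuation_of_log (k : ℂ) {z : ℂ} (hz : 1 - z ∈ slitPlane)
    {l : ℂ → ℂ} (hl : DifferentiableAt ℂ l z) (hexp : ∀ᶠ w in 𝓝 z, exp (l w) = w)
    (him : |(l z).im| < 2 * Real.pi) : DifferentiableAt ℂ (polylogContinuation k) z := by
  have hmem : l z ∈ slitStrip :=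
    mem_slitStrip_of_one_sub_exp_mem him (by rwa [hexp.self_of_nhds])
  have h1 : DifferentiableAt ℂ (polylogFormula k ∘ l) z :=
    (hasDerivAt_polylogFormula k hmem).differentiableAt.comp z hl
  refine h1.congr_of_eventuallyEq ?_
  filter_upwards [hexp, hl.continuousAt.eventually (isOpen_slitStrip.mem_nhds hmem)] with w h2 h3
  rw [Function.comp_apply, ← polylogContinuation_exp k h3.1, h2]

theorem isPolylogBranch_polylogContinuation (k : ℂ) :
    IsPolylogBranch (-k) (polylogContinuation k) := by
  refine ⟨fun z hz => DifferentiableAt.differentiableWithinAt ?_, fun z hz => ?_⟩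
  · by_cases h : ‖z‖ < 1
    · obtain ⟨d, hd, -⟩ := hasDerivAt_polylogSeries (-k) h
      refine hd.differentiableAt.congr_of_eventuallyEq ?_
      filter_upwards [(isOpen_lt continuous_norm continuous_const).mem_nhds h] with w hw
      exact if_pos hw
    have h0 : z ≠ 0 := by
      rintro rfl
      simp at h
    have hev : ∀ᶠ w in 𝓝 z, w ≠ 0 := isOpen_ne.mem_nhds h0
    by_cases hs : z ∈ slitPlane
    · exact differentiableAt_polylogContinuation_of_log k hz (differentiableAt_log hs)
        (hev.mono fun w hw => exp_log hw) (abs_log_im_lt_two_pi z)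
    -- On the negative axis the principal logarithm jumps; `log(-w) + πi` is holomorphic there and
    -- stays in the strip.
    · have hs' : -z ∈ slitPlane := by
        rw [mem_slitPlane_iff, not_or, not_lt, not_not] at hs
        left
        rw [neg_re, neg_pos]
        exact lt_of_le_of_ne hs.1 fun hre => h0 (ext hre hs.2)
      have hl : DifferentiableAt ℂ (fun w => log (-w) + Real.pi * I) z :=
        ((differentiableAt_log hs').comp z differentiableAt_id.neg).add_const _
      refine differentiableAt_polylogContinuation_of_log k hz hl ?_ ?_
      · filter_upwards [hev] with w hw
        rw [exp_add, exp_log (neg_ne_zero.mpr hw), exp_pi_mul_I]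
        ring
      · have h1 : (log (-z) + Real.pi * I).im = arg (-z) + Real.pi := by simp [log_im]
        rw [h1, abs_lt]
        have h2 := neg_pi_lt_arg (-z)
        have h3 := (arg_le_pi (-z)).lt_of_ne (mem_slitPlane_iff_arg.mp hs').1
        exact ⟨by linarith [Real.pi_pos], by linarith⟩
  · rw [polylogContinuation, if_pos hz]
    exact hasSum_polylogSeries (-k) hz

theorem isPolylogBranch_polylogBranch (k : ℂ) : IsPolylogBranch (-k) (polylogBranch (-k)) :=
  Classical.epsilon_spec ⟨_, isPolylogBranch_polylogContinuation k⟩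

/-- Pulled back by `exp`, any branch is holomorphic on the connected `slitStrip` and agrees with the
formula on the negative axis. -/
theorem polylogBranch_exp (k : ℂ) {m : ℂ} (hm : m ∈ slitStrip) :
    polylogBranch (-k) (exp m) = polylogFormula k m := by
  obtain ⟨hd, hs⟩ := isPolylogBranch_polylogBranch k
  refine eqOn_of_eventuallyEq_ofReal isOpen_slitStrip isPreconnected_slitStrip (x₀ := -1)
    (f := fun m => polylogBranch (-k) (exp m)) (g := polylogFormula k) ?_
    (differentiableOn_polylogFormula k) (ofReal_mem_slitStrip (by norm_num)) ?_ hm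
  · exact hd.comp differentiable_exp.differentiableOn fun m hm => one_sub_exp_mem_slitPlane hm
  · filter_upwards [gt_mem_nhds (show (-1 : ℝ) < 0 by norm_num)] with t ht
    have h1 : ‖exp (t : ℂ)‖ < 1 := by rw [norm_exp]; simpa using ht
    rw [polylogFormula_ofReal_eq k ht]
    exact (hs _ h1).unique (hasSum_polylogSeries (-k) h1)

/-! ### Values on the cut. -/

/-- On the cut the integral formula is continuous from below. -/
theorem tendsto_polylogFormula_of_pos (k : ℂ) {t : ℝ} (ht : 0 < t) :
    Tendsto (polylogFormula k) (𝓝[{m : ℂ | m.im < 0}] (t : ℂ)) (𝓝 (polylogFormula k t)) := by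
  have hneg : Tendsto (fun m : ℂ => -m) (𝓝[{m : ℂ | m.im < 0}] (t : ℂ))
      (𝓝[{z : ℂ | 0 < z.im}] (-t : ℂ)) := by
    refine tendsto_nhdsWithin_iff.mpr
      ⟨(continuous_neg.tendsto _).mono_left nhdsWithin_le_nhds, ?_⟩
    filter_upwards [self_mem_nhdsWithin] with m hm
    simpa using hm
  have h1 := (tendsto_upperIncompleteGamma_of_neg (k + 1) (z₀ := -t) (by simp)
    (by simpa using ht)).comp hneg
  have hlog : Tendsto log (𝓝[{z : ℂ | 0 < z.im}] (-t : ℂ)) (𝓝 (log (-t))) :=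
    (continuousWithinAt_log_of_re_neg_of_im_zero (z := -t) (by simpa using ht) (by simp)).mono
      (fun z (hz : 0 < z.im) => hz.le)
  have hpow : Tendsto (fun m : ℂ => (-m) ^ (-k - 1)) (𝓝[{m : ℂ | m.im < 0}] (t : ℂ))
      (𝓝 ((-t : ℂ) ^ (-k - 1))) := by
    have ht0 : (-t : ℂ) ≠ 0 := by
      rw [neg_ne_zero]; exact_mod_cast ht.ne'
    rw [cpow_def_of_ne_zero ht0]
    refine Tendsto.congr' ?_ ((continuous_exp.tendsto _).comp
      ((hlog.comp hneg).mul_const (-k - 1)))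
    filter_upwards [self_mem_nhdsWithin] with m hm
    have hm0 : -m ≠ 0 := by
      intro h
      have : m.im = 0 := by rw [neg_eq_zero.mp h, zero_im]
      exact absurd hm (by simp [this])
    rw [cpow_def_of_ne_zero hm0]
    rfl
  have hexp : Tendsto exp (𝓝[{m : ℂ | m.im < 0}] (t : ℂ)) (𝓝 (exp t)) :=
    (continuous_exp.tendsto _).mono_left nhdsWithin_le_nhds
  have hint : Tendsto (fun m => ∫ x in Ioi (0 : ℝ), polylogIntegrand k m x)
      (𝓝[{m : ℂ | m.im < 0}] (t : ℂ)) (𝓝 (∫ x in Ioi (0 : ℝ), polylogIntegrand k t x)) :=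
    (hasDerivAt_integral_polylogIntegrand k
      (by simp [Real.pi_pos])).continuousAt.tendsto.mono_left nhdsWithin_le_nhds
  exact ((hexp.div_const 2).add (hpow.mul h1)).sub (((hexp.const_mul I).div_const 2).mul hint)

theorem tendsto_polylogBranch_exp_of_pos (k : ℂ) {t : ℝ} (ht : 0 < t) :
    Tendsto (polylogBranch (-k)) (𝓝[{w : ℂ | w.im < 0}] (exp t)) (𝓝 (polylogFormula k t)) := by
  have hslit : exp (t : ℂ) ∈ slitPlane := by
    rw [← ofReal_exp, ofReal_mem_slitPlane]; exact Real.exp_pos t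
  have hlogt : log (exp (t : ℂ)) = t := by
    rw [log_exp] <;> simp [Real.pi_pos, Real.pi_pos.le]
  -- The principal logarithm preserves the lower half-plane, so an approach to `e^t` from below is
  -- an approach to `t` from below.
  have hlog : Tendsto log (𝓝[{w : ℂ | w.im < 0}] (exp t)) (𝓝[{m : ℂ | m.im < 0}] (t : ℂ)) := by
    refine tendsto_nhdsWithin_iff.mpr ⟨?_, ?_⟩
    · have := (continuousAt_clog hslit).tendsto
      rw [hlogt] at this
      exact this.mono_left nhdsWithin_le_nhds
    · filter_upwards [self_mem_nhdsWithin] with w hw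
      rw [log_im]
      exact arg_neg_iff.mpr hw
  refine Tendsto.congr' ?_ ((tendsto_polylogFormula_of_pos k ht).comp hlog)
  filter_upwards [self_mem_nhdsWithin] with w hw
  have hw : w.im < 0 := hw
  have hw0 : w ≠ 0 := by
    rintro rfl
    simp at hw
  have hmem : log w ∈ slitStrip := by
    refine ⟨abs_log_im_lt_two_pi w, Or.inr ?_⟩
    rw [neg_im, log_im, neg_ne_zero]
    exact (arg_neg_iff.mpr hw).ne
  rw [Function.comp_apply, ← polylogBranch_exp k hmem, exp_log hw0]

theorem nhdsWithin_im_neg_neBot {z : ℂ} (hz : z.im = 0) : (𝓝[{w : ℂ | w.im < 0}] z).NeBot := by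
  rw [← mem_closure_iff_nhdsWithin_neBot, Complex.closure_setOfPred_im_lt]
  exact hz.le

theorem polylog_exp_eq (k : ℂ) {m : ℂ} (hm : exp m ≠ 1) (him : |m.im| < 2 * Real.pi) :
    polylog (-k) (exp m) = polylogFormula k m := by
  rw [polylog]
  split_ifs with h
  · exact polylogBranch_exp k (mem_slitStrip_of_one_sub_exp_mem him h)
  · have hcon : -m ∉ slitPlane := fun hs => h (one_sub_exp_mem_slitPlane ⟨him, hs⟩)
    rw [mem_slitPlane_iff, not_or, neg_re, neg_im, not_lt, not_not] at hcon
    obtain ⟨t, rfl⟩ : ∃ t : ℝ, m = t := ⟨m.re, ext rfl (by simpa using hcon.2)⟩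
    have ht0 : 0 ≤ t := by simpa using hcon.1
    -- Only here is `e^m ≠ 1` needed: it excludes the branch point `t = 0`.
    have ht : 0 < t := ht0.lt_of_ne fun h0 => hm (by simp [← h0])
    have : (𝓝[{w : ℂ | w.im < 0}] (exp (t : ℂ))).NeBot :=
      nhdsWithin_im_neg_neBot (by rw [← ofReal_exp, ofReal_im])
    exact (tendsto_polylogBranch_exp_of_pos k ht).limUnder_eq

end

theorem mainTheorem3 (k m : ℂ) (hm : Complex.exp m ≠ 1) (him : |m.im| < 2 * Real.pi) :
    MeasureTheory.IntegrableOn (polylogIntegrand k m) (Set.Ioi (0 : ℝ)) ∧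
      polylog (-k) (Complex.exp m) =
        Complex.exp m / 2 + (-m) ^ (-k - 1) * upperIncompleteGamma (k + 1) (-m) -
          Complex.I * Complex.exp m / 2 *
            ∫ x in Set.Ioi (0 : ℝ), polylogIntegrand k m x := by
  exact ⟨integrableOn_polylogIntegrand k him, polylog_exp_eq k hm him⟩
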